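/- Let $m,n\ge 0$ and $0\le r_\star\le r$ be integers and let $\alpha>0$, $\beta, D, R$ be real numbers. There is a constant $c>0$, depending only on $(m,n,r,r_\star,\alpha,\beta,D,R)$, such that the following holds for every $\varepsilon>0$, every $\lambda\ge 0$ and every $\delta\le c\,\varepsilon^3$ (in particular, whenever $\delta=\delta(\varepsilon)=o(\varepsilon^3)$ as $\varepsilon\to0$, for all sufficiently small $\varepsilon$, with the other parameters fixed). Write $\|\cdot\|_F$ for the Frobenius norm, $\sigma_1(X)\ge\sigma_2(X)\ge\dots\ge 0$ for the singular values of $X$ (with $\sigma_k(X)=0$ for $k>\mathrm{rank}(X)$), and $\|X\|_*=\sum_k\sigma_k(X)$. Let $f:\mathbb{R}^{m\times n}\to\mathbb{R}$ be twice differentiable (the unregularized full fine-tuning loss), and put \[ f_\lambda(X)=f(X)+\lambda\|X\|_*,\qquad g_\lambda(A,B)=f(AB^\intercal)+\tfrac{\lambda}{2}\big(\|A\|_F^2+\|B\|_F^2\big),\quad A\in\mathbb{R}^{m\times r},\ B\in\mathbb{R}^{n\times r}. \] For $\eta\ge0$, a matrix is an $\eta$-global minimizer if it lies within Frobenius distance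 $\eta$ of some exact global minimizer of $f_\lambda$. Let $X_\star$ be an exact global minimizer of $f_\lambda$ with $\|X_\star\|_F\le R$, and let $X_\star^{(\delta)}$ be a matrix of rank $r_\star$ with $\|X_\star^{(\delta)}-X_\star\|_F\le\delta$. Assume that, for every $X$ with $\mathrm{rank}(X)\le r$ and $\|X-X_\star\|_F\le D$, \[ \langle\nabla f(X)-\nabla f(X_\star),X-X_\star\rangle\ge\alpha\|X-X_\star\|_F^2 \] and \[ \nabla^2 f(X)[UX+XV,UX+XV]\le\beta\|UX+XV\|_F^2 \] for all $U\in\mathbb{R}^{m\times m}$ and $V\in\mathbb{R}^{n\times n}$ of rank one and Frobenius norm one (for example, $\alpha$ and $\beta$ are the best such constants). Let $(A,B)$ be any second-order stationary point of $g_\lambda$ (vanishing gradient, positive semidefinite Hessian) such that $X=AB^\intercal$ satisfies $\|X-X_\star\|_F\le D$. Then: 1. If $2\alpha\ge\beta(1+\varepsilon)$, then $X$ is an $\varepsilon$-global minimizer. 2. If $2\alpha<\beta(1+\varepsilon)$, then one of the following holds: (i) $X$ is an $\varepsilon$-global minimizer; (ii) $X$ is not an $\varepsilon$-global minimizer, $r_\star\ge1$,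 $\mathrm{rank}(X)=r$, \[ \sigma_r(X)\ge\max\Big\{\frac{2\alpha}{\beta(1+\varepsilon)}\sigma_{r_\star}(X),\ \frac{\alpha}{2\beta\sqrt r}\,\varepsilon\Big\}, \] and either $\sigma_r(X)\le\frac{2\alpha}{\beta}\sigma_{r_\star}(X)$, or \[ \|X-X_\star\|_F\ge\sqrt{\frac{\|X-\Pi(X)\|_F^2-\varepsilon^3}{1-\frac{2\alpha\sigma_{r_\star}(X)}{\beta\sigma_r(X)}}}-\varepsilon^2 \] for every Frobenius-nearest projection $\Pi(X)$ of $X$ onto the set of matrices of rank at most $r_\star$ (the square root of a negative number being read as $0$). -/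

import Mathlib

open Matrix

/- Matrices carry the Frobenius norm throughout. -/
attribute [local instance] Matrix.frobeniusNormedAddCommGroup Matrix.frobeniusNormedSpace

namespace LoRA

/-- The `k`-th largest singular value `σ_k(X)` of a real matrix, for `k = 1, 2, …`
(Mathlib's sequence of singular values is indexed from `0`; it is zero beyond the rank). -/
noncomputable def sigma {m n : ℕ} (X : Matrix (Fin m) (Fin n) ℝ) (k : ℕ) : ℝ :=
  (Matrix.toEuclideanLin X).singularValues (k - 1)

/-- The nuclear norm: the sum of the singular values. -/
noncomputable def nuclearNorm {m n : ℕ} (X : Matrix (Fin m) (Fin n) ℝ) : ℝ :=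
  ∑ k ∈ Finset.Icc 1 (min m n), sigma X k

/-- The nuclear-norm regularized full fine-tuning loss `f(X) + λ ‖X‖_*`. -/
noncomputable def fullLoss {m n : ℕ} (f : Matrix (Fin m) (Fin n) ℝ → ℝ) (lam : ℝ)
    (X : Matrix (Fin m) (Fin n) ℝ) : ℝ :=
  f X + lam * nuclearNorm X

/-- The weight-decayed rank-`r` LoRA loss `f(A Bᵀ) + (λ / 2) (‖A‖_F² + ‖B‖_F²)`. -/
noncomputable def loraLoss {m n : ℕ} (r : ℕ) (f : Matrix (Fin m) (Fin n) ℝ → ℝ) (lam : ℝ)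
    (p : Matrix (Fin m) (Fin r) ℝ × Matrix (Fin n) (Fin r) ℝ) : ℝ :=
  f (p.1 * p.2ᵀ) + lam / 2 * (‖p.1‖ ^ 2 + ‖p.2‖ ^ 2)

/-- The derivative of `L` at `x` in the direction `u`, i.e. the pairing of the gradient with `u`. -/
noncomputable def gradPair {E : Type*} [NormedAddCommGroup E] [NormedSpace ℝ E] (L : E → ℝ)
    (x u : E) : ℝ :=
  fderiv ℝ L x u

/-- The Hessian quadratic form `∇²L(x)[u, u]`. -/
noncomputable def hessQuad {E : Type*} [NormedAddCommGroup E] [NormedSpace ℝ E] (L : E → ℝ)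
    (x u : E) : ℝ :=
  fderiv ℝ (fderiv ℝ L) x u u

/-- `L` is twice (Fréchet) differentiable everywhere. -/
def TwiceDifferentiable {E : Type*} [NormedAddCommGroup E] [NormedSpace ℝ E] (L : E → ℝ) : Prop :=
  Differentiable ℝ L ∧ Differentiable ℝ (fderiv ℝ L)

/-- Second-order stationary point: the gradient vanishes and the Hessian is positive
semidefinite. -/
def IsSOSP {E : Type*} [NormedAddCommGroup E] [NormedSpace ℝ E] (L : E → ℝ) (x : E) : Prop :=
  (∀ u : E, gradPair L x u = 0) ∧ ∀ u : E, 0 ≤ hessQuad L x u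

/-- `X` minimizes `F` globally. -/
def IsGlobalMinimizer {m n : ℕ} (F : Matrix (Fin m) (Fin n) ℝ → ℝ)
    (X : Matrix (Fin m) (Fin n) ℝ) : Prop :=
  ∀ Y, F X ≤ F Y

/-- `X` is an `ε`-global minimizer of `F`: within Frobenius distance `ε` of an exact one. -/
def IsApproxGlobalMinimizer {m n : ℕ} (F : Matrix (Fin m) (Fin n) ℝ → ℝ) (ε : ℝ)
    (X : Matrix (Fin m) (Fin n) ℝ) : Prop :=
  ∃ Xs, IsGlobalMinimizer F Xs ∧ ‖X - Xs‖ ≤ ε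

/-- `(α, r, D)`-restricted strong convexity of `f` about `Xs`. -/
def RestrictedStronglyConvex {m n : ℕ} (f : Matrix (Fin m) (Fin n) ℝ → ℝ)
    (Xs : Matrix (Fin m) (Fin n) ℝ) (α : ℝ) (r : ℕ) (D : ℝ) : Prop :=
  ∀ X : Matrix (Fin m) (Fin n) ℝ, ‖X - Xs‖ ≤ D → X.rank ≤ r →
    α * ‖X - Xs‖ ^ 2 ≤ gradPair f X (X - Xs) - gradPair f Xs (X - Xs)

/-- `(β, r, D)`-restricted smoothness of `f` about `Xs`. -/
def RestrictedSmooth {m n : ℕ} (f : Matrix (Fin m) (Fin n) ℝ → ℝ)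
    (Xs : Matrix (Fin m) (Fin n) ℝ) (β : ℝ) (r : ℕ) (D : ℝ) : Prop :=
  ∀ X : Matrix (Fin m) (Fin n) ℝ, ‖X - Xs‖ ≤ D → X.rank ≤ r →
    ∀ (U : Matrix (Fin m) (Fin m) ℝ) (V : Matrix (Fin n) (Fin n) ℝ),
      U.rank = 1 → ‖U‖ = 1 → V.rank = 1 → ‖V‖ = 1 →
      hessQuad f X (U * X + X * V) ≤ β * ‖U * X + X * V‖ ^ 2

/-- `P` is a (Frobenius-nearest) projection of `X` onto the matrices of rank at most `k`. -/
def IsRankProjection {m n : ℕ} (k : ℕ) (X P : Matrix (Fin m) (Fin n) ℝ) : Prop :=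
  P.rank ≤ k ∧ ∀ Y : Matrix (Fin m) (Fin n) ℝ, Y.rank ≤ k → ‖X - P‖ ≤ ‖X - Y‖

end LoRA

/-! Let X = ABᵀ, G = ∇f(X), ρ = ‖X - X⋆‖, and suppose ρ > ε. Stationarity makes G act as -λ times
the pairing of left and right singular vectors of X (`FactorSOSP.mul_right`, `FactorSOSP.mul_left`)
and gives ⟨G, X⟩ ≤ -λ‖X‖_*. With the subgradient inequality at X⋆ and restricted strong convexity
this yields αρ² ≤ -⟨G, X⋆⟩ - λ‖X⋆‖_* (`mul_norm_sq_le_neg_ip`), so X can differ from X⋆ only as far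
as the operator norm of G exceeds λ.

If rank X < r, an idle direction in the factors and the second-order condition force that norm to be
at most λ, a contradiction. If rank X = r, perturbing both factors at once bounds G by λ + βσ_r on
the complement of the singular spaces (`FactorSOSP.dotProduct_le`). Hence -G is a matrix of operator
norm at most λ plus βσ_r W, with W a contraction supported on that complement
(`exists_excess_contraction`), and αρ² ≤ βσ_r⟨W, X⋆⟩.

The pairing ⟨W, X⋆⟩ is controlled by rank. For τ = σ_{r⋆}(X), adding τW to X does not increase the
sum of its top r⋆ squared singular values (`IsSVD.norm_sq_mul_le`), so 2τ⟨W, Y⟩ + T ≤ ‖X - Y‖² for Y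
of rank r⋆, where T is the squared tail of X. Replacing Y by X⋆ costs O(δ) ≤ ε³ < ερ². Eliminating
⟨W, X⋆⟩ gives 2ατ < β(1+ε)σ_r and the distance bound (`numeric_bounds`). The absolute lower bound on
σ_r uses instead ⟨W, X⋆⟩ ≤ 2√r ρ, since W kills the singular spaces of X (`IsSVD.ip_le_sqrt_mul`).
-/

namespace LoRA

variable {m n k l r : ℕ}

/-! ### Frobenius geometry and orthonormal columns. -/

/-- The Frobenius inner product. -/
def ip (A B : Matrix (Fin m) (Fin n) ℝ) : ℝ := (Aᵀ * B).trace

theorem ip_eq_sum (A B : Matrix (Fin m) (Fin n) ℝ) : ip A B = ∑ j, ∑ i, A i j * B i j := by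
  simp [ip, Matrix.trace, Matrix.mul_apply]

theorem ip_comm (A B : Matrix (Fin m) (Fin n) ℝ) : ip A B = ip B A := by
  simp [ip_eq_sum, mul_comm]

theorem ip_add_left (A B C : Matrix (Fin m) (Fin n) ℝ) : ip (A + B) C = ip A C + ip B C := by
  simp [ip, Matrix.add_mul]

theorem ip_add_right (A B C : Matrix (Fin m) (Fin n) ℝ) : ip A (B + C) = ip A B + ip A C := by
  simp [ip, Matrix.mul_add]

theorem ip_sub_left (A B C : Matrix (Fin m) (Fin n) ℝ) : ip (A - B) C = ip A C - ip B C := by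
  simp [ip, Matrix.sub_mul]

theorem ip_sub_right (A B C : Matrix (Fin m) (Fin n) ℝ) : ip A (B - C) = ip A B - ip A C := by
  simp [ip, Matrix.mul_sub]

theorem ip_neg_left (A B : Matrix (Fin m) (Fin n) ℝ) : ip (-A) B = -ip A B := by
  simp [ip]

theorem ip_smul_left (t : ℝ) (A B : Matrix (Fin m) (Fin n) ℝ) : ip (t • A) B = t * ip A B := by
  simp [ip]

theorem ip_smul_right (t : ℝ) (A B : Matrix (Fin m) (Fin n) ℝ) : ip A (t • B) = t * ip A B := by
  simp [ip]

theorem ip_mul_left (M : Matrix (Fin m) (Fin k) ℝ) (A : Matrix (Fin k) (Fin n) ℝ)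
    (B : Matrix (Fin m) (Fin n) ℝ) : ip (M * A) B = ip A (Mᵀ * B) := by
  simp [ip, Matrix.mul_assoc]

theorem ip_mul_right (A : Matrix (Fin m) (Fin k) ℝ) (M : Matrix (Fin k) (Fin n) ℝ)
    (B : Matrix (Fin m) (Fin n) ℝ) : ip (A * M) B = ip A (B * Mᵀ) := by
  rw [ip, ip, transpose_mul, ← Matrix.mul_assoc, Matrix.mul_assoc, Matrix.trace_mul_comm]

theorem ip_vecMulVec (A : Matrix (Fin m) (Fin n) ℝ) (u : Fin m → ℝ) (v : Fin n → ℝ) :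
    ip A (vecMulVec u v) = u ⬝ᵥ (A *ᵥ v) := by
  simp only [ip_eq_sum, vecMulVec_apply, dotProduct, mulVec, Finset.mul_sum]
  rw [Finset.sum_comm]
  exact Finset.sum_congr rfl fun i _ => Finset.sum_congr rfl fun j _ => by ring

theorem norm_sq_eq_ip (A : Matrix (Fin m) (Fin n) ℝ) : ‖A‖ ^ 2 = ip A A := by
  rw [Matrix.frobenius_norm_def, ← Real.rpow_natCast, ← Real.rpow_mul (by positivity)]
  norm_num [ip_eq_sum]
  rw [Finset.sum_comm]
  simp [sq]

theorem ip_le_half (A B : Matrix (Fin m) (Fin n) ℝ) : 2 * ip A B ≤ ‖A‖ ^ 2 + ‖B‖ ^ 2 := by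
  have h : 0 ≤ ‖A - B‖ ^ 2 := by positivity
  rw [norm_sq_eq_ip] at h ⊢
  rw [norm_sq_eq_ip]
  simp only [ip_sub_left, ip_sub_right, ip_comm B A] at h
  linarith

theorem ip_le_norm_mul_norm (A B : Matrix (Fin m) (Fin n) ℝ) : ip A B ≤ ‖A‖ * ‖B‖ := by
  by_cases hA : ‖A‖ = 0
  · simp [norm_eq_zero.mp hA, ip]
  by_cases hB : ‖B‖ = 0
  · simp [norm_eq_zero.mp hB, ip]
  have h := ip_le_half (‖B‖ • A) (‖A‖ • B)
  rw [ip_smul_left, ip_smul_right, norm_smul, norm_smul, norm_norm, norm_norm] at h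
  have hpos : 0 < ‖B‖ * ‖A‖ := by positivity
  nlinarith

theorem abs_ip_le (A B : Matrix (Fin m) (Fin n) ℝ) : |ip A B| ≤ ‖A‖ * ‖B‖ := by
  refine abs_le.mpr ⟨?_, ip_le_norm_mul_norm A B⟩
  have := ip_le_norm_mul_norm (-A) B
  rw [ip_neg_left, norm_neg] at this
  linarith

theorem norm_sq_sub (A B : Matrix (Fin m) (Fin n) ℝ) :
    ‖A - B‖ ^ 2 = ‖A‖ ^ 2 + ‖B‖ ^ 2 - 2 * ip A B := by
  simp only [norm_sq_eq_ip, ip_sub_left, ip_sub_right, ip_comm B A]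
  ring

theorem norm_sq_eq_sum_col (A : Matrix (Fin m) (Fin n) ℝ) :
    ‖A‖ ^ 2 = ∑ j, (Aᵀ j ⬝ᵥ Aᵀ j) := by
  simp [norm_sq_eq_ip, ip_eq_sum, dotProduct]

theorem transpose_mul_apply (A : Matrix (Fin m) (Fin n) ℝ) (B : Matrix (Fin n) (Fin k) ℝ)
    (j : Fin k) : (A * B)ᵀ j = A *ᵥ (Bᵀ j) := by
  ext i
  simp [Matrix.mul_apply, mulVec, dotProduct]

theorem norm_sq_orthonormal {Q : Matrix (Fin n) (Fin k) ℝ} (hQ : Qᵀ * Q = 1) : ‖Q‖ ^ 2 = k := by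
  simp [norm_sq_eq_ip, ip, hQ]

theorem dotProduct_self_orthonormal_mulVec {Q : Matrix (Fin n) (Fin k) ℝ} (hQ : Qᵀ * Q = 1)
    (v : Fin k → ℝ) : (Q *ᵥ v) ⬝ᵥ (Q *ᵥ v) = v ⬝ᵥ v := by
  rw [dotProduct_mulVec, ← mulVec_transpose, mulVec_mulVec, hQ, one_mulVec]

/-- The Pythagorean identity for the projection onto the column space of `Q`. -/
theorem dotProduct_self_sub_proj {Q : Matrix (Fin n) (Fin k) ℝ} (hQ : Qᵀ * Q = 1)
    (v : Fin n → ℝ) :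
    (v - Q *ᵥ (Qᵀ *ᵥ v)) ⬝ᵥ (v - Q *ᵥ (Qᵀ *ᵥ v)) = v ⬝ᵥ v - (Qᵀ *ᵥ v) ⬝ᵥ (Qᵀ *ᵥ v) := by
  have h1 : v ⬝ᵥ Q *ᵥ (Qᵀ *ᵥ v) = (Qᵀ *ᵥ v) ⬝ᵥ (Qᵀ *ᵥ v) := by
    rw [dotProduct_mulVec, ← mulVec_transpose]
  rw [sub_dotProduct, dotProduct_sub, dotProduct_sub, dotProduct_self_orthonormal_mulVec hQ,
    dotProduct_comm (Q *ᵥ (Qᵀ *ᵥ v)) v, h1]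
  ring

theorem dotProduct_self_nonneg' (v : Fin n → ℝ) : 0 ≤ v ⬝ᵥ v :=
  Finset.sum_nonneg fun i _ => mul_self_nonneg (v i)

theorem bessel {Q : Matrix (Fin n) (Fin k) ℝ} (hQ : Qᵀ * Q = 1) (v : Fin n → ℝ) :
    (Qᵀ *ᵥ v) ⬝ᵥ (Qᵀ *ᵥ v) ≤ v ⬝ᵥ v := by
  have := dotProduct_self_nonneg' (v - Q *ᵥ (Qᵀ *ᵥ v))
  rw [dotProduct_self_sub_proj hQ] at this
  linarith

theorem two_mul_dotProduct_le (u v : Fin n → ℝ) : 2 * (u ⬝ᵥ v) ≤ u ⬝ᵥ u + v ⬝ᵥ v := by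
  have := dotProduct_self_nonneg' (u - v)
  rw [sub_dotProduct, dotProduct_sub, dotProduct_sub, dotProduct_comm v u] at this
  linarith

/-! ### Operator-norm bounds and contractions. -/

/-- `W` has operator norm at most `t`, in bilinear form. -/
def OpNormLE (t : ℝ) (W : Matrix (Fin m) (Fin n) ℝ) : Prop :=
  ∀ u v, 2 * (u ⬝ᵥ (W *ᵥ v)) ≤ t * (u ⬝ᵥ u + v ⬝ᵥ v)

/-- Testing the bilinear bound at u = Wv recovers the usual meaning of a contraction. -/
theorem OpNormLE.mulVec_le {W : Matrix (Fin m) (Fin n) ℝ} (hW : OpNormLE 1 W) (v : Fin n → ℝ) :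
    (W *ᵥ v) ⬝ᵥ (W *ᵥ v) ≤ v ⬝ᵥ v := by
  have := hW (W *ᵥ v) v
  linarith

theorem OpNormLE.smul {W : Matrix (Fin m) (Fin n) ℝ} {t c : ℝ} (hc : 0 ≤ c) (hW : OpNormLE t W) :
    OpNormLE (c * t) (c • W) := by
  intro u v
  rw [smul_mulVec, dotProduct_smul, smul_eq_mul]
  nlinarith [hW u v]

theorem OpNormLE.neg {W : Matrix (Fin m) (Fin n) ℝ} {t : ℝ} (hW : OpNormLE t W) :
    OpNormLE t (-W) := by
  intro u v
  have := hW (-u) v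
  simpa [neg_mulVec] using this

theorem OpNormLE.norm_mul_le {W : Matrix (Fin m) (Fin n) ℝ} (hW : OpNormLE 1 W)
    (Y : Matrix (Fin n) (Fin k) ℝ) : ‖W * Y‖ ≤ ‖Y‖ := by
  refine le_of_sq_le_sq ?_ (norm_nonneg _)
  rw [norm_sq_eq_sum_col, norm_sq_eq_sum_col]
  refine Finset.sum_le_sum fun j _ => ?_
  rw [transpose_mul_apply]
  exact hW.mulVec_le _

theorem norm_one_sq : ‖(1 : Matrix (Fin n) (Fin n) ℝ)‖ ^ 2 = n := by
  simp [norm_sq_eq_ip, ip]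

theorem OpNormLE.norm_sq_le {W : Matrix (Fin m) (Fin n) ℝ} (hW : OpNormLE 1 W) :
    ‖W‖ ^ 2 ≤ n := by
  have h := hW.norm_mul_le (1 : Matrix (Fin n) (Fin n) ℝ)
  rw [Matrix.mul_one] at h
  rw [← norm_one_sq (n := n)]
  exact pow_le_pow_left₀ (norm_nonneg _) h 2

/-- The sharp value √n is not needed: this bound only feeds the constant in front of δ. -/
theorem OpNormLE.norm_le {W : Matrix (Fin m) (Fin n) ℝ} (hW : OpNormLE 1 W) : ‖W‖ ≤ n + 1 := by
  refine le_of_sq_le_sq ?_ (by positivity)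
  have : (0 : ℝ) ≤ n := by positivity
  nlinarith [hW.norm_sq_le]

/-! ### Compact singular value decomposition. -/

/-- `X = P diag(s) Qᵀ` is a compact singular value decomposition. -/
structure IsSVD (X : Matrix (Fin m) (Fin n) ℝ) (P : Matrix (Fin m) (Fin k) ℝ) (s : Fin k → ℝ)
    (Q : Matrix (Fin n) (Fin k) ℝ) : Prop where
  left : Pᵀ * P = 1
  right : Qᵀ * Q = 1
  eq : X = P * diagonal s * Qᵀ
  pos : ∀ i, 0 < s i
  eq_sigma : ∀ i : Fin k, s i = sigma X (i + 1)

theorem finrank_range_toEuclideanLin (X : Matrix (Fin m) (Fin n) ℝ) :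
    Module.finrank ℝ (LinearMap.range (Matrix.toEuclideanLin X)) = X.rank := by
  rw [X.rank_eq_finrank_range_toLin (EuclideanSpace.basisFun _ ℝ).toBasis
    (EuclideanSpace.basisFun _ ℝ).toBasis, ← Matrix.toEuclideanLin_eq_toLin_orthonormal]

theorem sigma_antitone (X : Matrix (Fin m) (Fin n) ℝ) : Antitone (sigma X) := fun _ _ h =>
  (Matrix.toEuclideanLin X).singularValues_antitone (by omega)

theorem sigma_pos {X : Matrix (Fin m) (Fin n) ℝ} {i : ℕ} (hi : i < X.rank) :
    0 < sigma X (i + 1) := by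
  rw [sigma, LinearMap.singularValues_pos_iff_lt_finrank_range, finrank_range_toEuclideanLin]
  simpa using hi

theorem sigma_eq_zero {X : Matrix (Fin m) (Fin n) ℝ} {i : ℕ} (hi : X.rank ≤ i) :
    sigma X (i + 1) = 0 := by
  rw [sigma, LinearMap.singularValues_eq_zero_iff_le_finrank_range, finrank_range_toEuclideanLin]
  simpa using hi

/-- A full set of right singular vectors. -/
theorem exists_right_singular_basis (X : Matrix (Fin m) (Fin n) ℝ) :
    ∃ V : Matrix (Fin n) (Fin n) ℝ, Vᵀ * V = 1 ∧
      (X * V)ᵀ * (X * V) = diagonal fun i : Fin n => sigma X (i + 1) ^ 2 := by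
  let T := Matrix.toEuclideanLin X
  have hT := T.isSymmetric_adjoint_comp_self
  have hn : Module.finrank ℝ (EuclideanSpace ℝ (Fin n)) = n := by simp
  let b := hT.eigenvectorBasis hn
  have hin : ∀ i j, inner ℝ (b i) (b j) = if i = j then (1 : ℝ) else 0 :=
    orthonormal_iff_ite.mp b.orthonormal
  refine ⟨Matrix.of fun i j => b j i, ?_, ?_⟩
  · ext i j
    have := hin i j
    rw [EuclideanSpace.inner_eq_star_dotProduct] at this
    simp only [star_trivial, dotProduct] at this
    simp only [Matrix.mul_apply, transpose_apply, of_apply, Matrix.one_apply, ← this]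
    exact Finset.sum_congr rfl fun _ _ => mul_comm _ _
  · ext i j
    have h1 : inner ℝ (T (b i)) (T (b j)) = if i = j then sigma X (j + 1) ^ 2 else 0 := by
      rw [← LinearMap.adjoint_inner_right]
      have := hT.apply_eigenvectorBasis hn j
      rw [LinearMap.comp_apply] at this
      change T.adjoint (T (b j)) = _ • b j at this
      rw [this, inner_smul_right, hin, ← LinearMap.sq_singularValues_fin]
      simp [sigma, T]
    rw [EuclideanSpace.inner_eq_star_dotProduct] at h1
    simp only [star_trivial, dotProduct] at h1
    have h2 : ∀ x y, (T (b y)) x = (X * Matrix.of fun i j => b j i) x y := by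
      intro x y
      simp [T, Matrix.toLpLin_apply, mulVec, dotProduct, Matrix.mul_apply]
    simp only [h2] at h1
    rw [Matrix.mul_apply, diagonal_apply]
    simp only [transpose_apply]
    rw [show (if i = j then sigma X (i + 1) ^ 2 else 0) = if i = j then sigma X (j + 1) ^ 2 else 0
      from by split_ifs with h <;> simp_all, ← h1]
    exact Finset.sum_congr rfl fun _ _ => mul_comm _ _

/-- Q consists of the first k right singular vectors, and P = XQ diag(s)⁻¹. Truncation loses nothing
because X annihilates the remaining singular vectors. -/
theorem exists_isSVD (X : Matrix (Fin m) (Fin n) ℝ) (hk : X.rank = k) :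
    ∃ (P : Matrix (Fin m) (Fin k) ℝ) (s : Fin k → ℝ) (Q : Matrix (Fin n) (Fin k) ℝ),
      IsSVD X P s Q := by
  obtain ⟨V, hV, hXV⟩ := exists_right_singular_basis X
  have hkn : k ≤ n := by simpa [← hk] using X.rank_le_width
  let s : Fin k → ℝ := fun i => sigma X (i + 1)
  have hs : ∀ i, 0 < s i := fun i => sigma_pos (by rw [hk]; exact i.2)
  let Q : Matrix (Fin n) (Fin k) ℝ := V.submatrix id (Fin.castLE hkn)
  have hQ : Qᵀ * Q = 1 := by
    ext i j
    have := congrFun (congrFun hV (Fin.castLE hkn i)) (Fin.castLE hkn j)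
    simpa [Q, Matrix.mul_apply, Matrix.one_apply, Fin.castLE_inj] using this
  have hXQ : (X * Q)ᵀ * (X * Q) = diagonal fun i => s i ^ 2 := by
    ext i j
    have := congrFun (congrFun hXV (Fin.castLE hkn i)) (Fin.castLE hkn j)
    simpa [Q, Matrix.mul_apply, Matrix.diagonal_apply, Fin.castLE_inj, s] using this
  have hPS : X * Q = X * Q * diagonal (fun i => (s i)⁻¹) * diagonal s := by
    rw [Matrix.mul_assoc, diagonal_mul_diagonal]
    simp [(hs _).ne']
  have hX : X = X * Q * Qᵀ := by
    have h1 : X = X * V * Vᵀ := by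
      rw [Matrix.mul_assoc, mul_eq_one_comm.mp hV, Matrix.mul_one]
    ext i j
    have h2 : (X * Q * Qᵀ) i j = (X * V * Vᵀ) i j := by
      rw [Matrix.mul_apply, Matrix.mul_apply]
      refine Fintype.sum_of_injective (Fin.castLE hkn) (Fin.castLE_injective hkn) _ _ ?_ ?_
      · intro l hl
        have hl' : k ≤ l := by
          by_contra h
          exact hl ⟨⟨l, by omega⟩, rfl⟩
        have h3 := congrFun (congrFun hXV l) l
        rw [diagonal_apply_eq, sigma_eq_zero (hk ▸ hl'), Matrix.mul_apply] at h3
        have h4 : ∑ x, (X * V) x l * (X * V) x l = 0 := by simpa using h3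
        have h5 := (Finset.sum_eq_zero_iff_of_nonneg fun x _ => mul_self_nonneg _).mp h4 i
          (Finset.mem_univ i)
        rw [mul_self_eq_zero.mp h5, zero_mul]
      · intro l
        simp [Q, Matrix.mul_apply]
    rw [h2, ← h1]
  refine ⟨X * Q * diagonal fun i => (s i)⁻¹, s, Q, ?_, hQ, ?_, hs, fun _ => rfl⟩
  · rw [transpose_mul, diagonal_transpose, Matrix.mul_assoc, ← Matrix.mul_assoc (X * Q)ᵀ, hXQ,
      diagonal_mul_diagonal, diagonal_mul_diagonal]
    rw [← diagonal_one]
    congr 1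
    ext i
    have := (hs i).ne'
    field_simp
  · rw [← hPS, ← hX]

/-! ### The nuclear norm and its duality with contractions. -/

theorem nuclearNorm_eq_sum {X : Matrix (Fin m) (Fin n) ℝ} {P : Matrix (Fin m) (Fin k) ℝ}
    {s : Fin k → ℝ} {Q : Matrix (Fin n) (Fin k) ℝ} (h : IsSVD X P s Q) (hk : X.rank = k) :
    nuclearNorm X = ∑ i, s i := by
  have hkn : k ≤ n := by simpa [← hk] using X.rank_le_width
  have hkm : k ≤ m := by simpa [← hk] using X.rank_le_height
  rw [nuclearNorm, Finset.sum_congr rfl fun i _ => h.eq_sigma i,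
    Fin.sum_univ_eq_sum_range (fun i => sigma X (i + 1)) k,
    Finset.sum_bij (s := Finset.range k) (t := Finset.Icc 1 k) (fun i _ => i + 1)
      (g := fun i => sigma X i)]
  · symm
    refine Finset.sum_subset (Finset.Icc_subset_Icc_right (le_min hkm hkn)) fun i hi hik => ?_
    simp only [Finset.mem_Icc] at hi hik
    obtain ⟨j, rfl⟩ : ∃ j, i = j + 1 := ⟨i - 1, by omega⟩
    exact sigma_eq_zero (by omega)
  · intro i hi
    simp only [Finset.mem_range, Finset.mem_Icc] at *
    omega
  · intro a _ b _ hab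
    omega
  · intro b hb
    simp only [Finset.mem_Icc] at hb
    exact ⟨b - 1, by simp; omega, by omega⟩
  · intro a _
    rfl

theorem opNormLE_mul_transpose {P : Matrix (Fin m) (Fin k) ℝ}
    {Q : Matrix (Fin n) (Fin k) ℝ} (hP : Pᵀ * P = 1) (hQ : Qᵀ * Q = 1) : OpNormLE 1 (P * Qᵀ) := by
  intro u v
  rw [← mulVec_mulVec, dotProduct_mulVec, ← mulVec_transpose]
  have := two_mul_dotProduct_le (Pᵀ *ᵥ u) (Qᵀ *ᵥ v)
  linarith [bessel hP u, bessel hQ v]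

theorem IsSVD.ip_eq {X : Matrix (Fin m) (Fin n) ℝ} {P : Matrix (Fin m) (Fin k) ℝ}
    {s : Fin k → ℝ} {Q : Matrix (Fin n) (Fin k) ℝ} (h : IsSVD X P s Q)
    (W : Matrix (Fin m) (Fin n) ℝ) : ip W X = ∑ i, s i * (Pᵀ i ⬝ᵥ (W *ᵥ Qᵀ i)) := by
  have : ip W X = ip (Pᵀ * W * Q) (diagonal s) := by
    rw [ip_mul_right, ip_mul_left, transpose_transpose, ← Matrix.mul_assoc, ← h.eq]
  rw [this, ip_eq_sum]
  refine Finset.sum_congr rfl fun i _ => ?_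
  rw [Finset.sum_eq_single i (fun b _ hb => by rw [diagonal_apply_ne _ hb, mul_zero]) (by simp),
    diagonal_apply_eq, mul_comm, Matrix.mul_assoc, Matrix.mul_apply, dotProduct,
    ← transpose_mul_apply]
  rfl

theorem col_dotProduct_self {Q : Matrix (Fin n) (Fin k) ℝ} (hQ : Qᵀ * Q = 1) (i : Fin k) :
    Qᵀ i ⬝ᵥ Qᵀ i = 1 := by
  have := congrFun (congrFun hQ i) i
  rw [Matrix.mul_apply, Matrix.one_apply_eq] at this
  exact this

theorem OpNormLE.ip_le_nuclearNorm {W : Matrix (Fin m) (Fin n) ℝ} {t : ℝ} (hW : OpNormLE t W)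
    (X : Matrix (Fin m) (Fin n) ℝ) : ip W X ≤ t * nuclearNorm X := by
  obtain ⟨P, s, Q, h⟩ := exists_isSVD X rfl
  rw [nuclearNorm_eq_sum h rfl, h.ip_eq, Finset.mul_sum]
  refine Finset.sum_le_sum fun i _ => ?_
  have := hW (Pᵀ i) (Qᵀ i)
  rw [col_dotProduct_self h.left, col_dotProduct_self h.right] at this
  nlinarith [h.pos i]

/-- The polar factor PQᵀ attains the duality bound. So the nuclear norm is a maximum of linear
functionals, from which convexity and the factorization bound follow. -/
theorem exists_ip_eq_nuclearNorm (X : Matrix (Fin m) (Fin n) ℝ) :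
    ∃ W : Matrix (Fin m) (Fin n) ℝ, OpNormLE 1 W ∧ ip W X = nuclearNorm X := by
  obtain ⟨k, hk⟩ : ∃ k, X.rank = k := ⟨_, rfl⟩
  obtain ⟨P, s, Q, h⟩ := exists_isSVD X hk
  refine ⟨P * Qᵀ, opNormLE_mul_transpose h.left h.right, ?_⟩
  rw [nuclearNorm_eq_sum h hk, h.eq, ip_mul_right, transpose_transpose, Matrix.mul_assoc,
    h.right, Matrix.mul_one, ip_comm, ip_mul_left, h.left]
  simp [ip]

theorem nuclearNorm_convex (X Y : Matrix (Fin m) (Fin n) ℝ) {t : ℝ} (h0 : 0 ≤ t) (h1 : t ≤ 1) :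
    nuclearNorm (X + t • (Y - X)) ≤ nuclearNorm X + t * (nuclearNorm Y - nuclearNorm X) := by
  obtain ⟨W, hW, he⟩ := exists_ip_eq_nuclearNorm (X + t • (Y - X))
  rw [← he, ip_add_right, ip_smul_right, ip_sub_right]
  nlinarith [hW.ip_le_nuclearNorm X, hW.ip_le_nuclearNorm Y]

/-- For the dual certificate W, ⟨W, ABᵀ⟩ = ⟨WB, A⟩; then Young's inequality and ‖WB‖ ≤ ‖B‖ finish.
-/
theorem two_mul_nuclearNorm_mul_le (A : Matrix (Fin m) (Fin k) ℝ) (B : Matrix (Fin n) (Fin k) ℝ) :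
    2 * nuclearNorm (A * Bᵀ) ≤ ‖A‖ ^ 2 + ‖B‖ ^ 2 := by
  obtain ⟨W, hW, he⟩ := exists_ip_eq_nuclearNorm (A * Bᵀ)
  have h1 : ip W (A * Bᵀ) = ip (W * B) A := by rw [ip_mul_right]
  rw [← he, h1]
  have h2 := pow_le_pow_left₀ (norm_nonneg _) (hW.norm_mul_le B) 2
  linarith [ip_le_half (W * B) A]

/-! ### Gradients as matrices, derivatives along curves, first-order optimality. -/

theorem exists_ip_representation (φ : Matrix (Fin m) (Fin n) ℝ →L[ℝ] ℝ) :
    ∃ G : Matrix (Fin m) (Fin n) ℝ, ∀ H, φ H = ip G H := by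
  refine ⟨Matrix.of fun i j => φ (Matrix.single i j 1), fun H => ?_⟩
  conv_lhs => rw [Matrix.matrix_eq_sum_single H]
  rw [map_sum, ip_eq_sum, Finset.sum_comm]
  refine Finset.sum_congr rfl fun i _ => ?_
  rw [map_sum]
  refine Finset.sum_congr rfl fun j _ => ?_
  rw [show Matrix.single i j (H i j) = H i j • Matrix.single i j (1 : ℝ) by simp, map_smul,
    smul_eq_mul, mul_comm]
  rfl

section Line

variable {E : Type*} [NormedAddCommGroup E] [NormedSpace ℝ E]

theorem hasDerivAt_parabola (x u v : E) :
    HasDerivAt (fun t : ℝ => x + t • u + (t * t) • v) u 0 := by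
  have h3 := ((hasDerivAt_id (0 : ℝ)).smul_const u).const_add x
  have h4 := ((hasDerivAt_id (0 : ℝ)).mul (hasDerivAt_id (0 : ℝ))).smul_const v
  simpa using! h3.add h4

theorem hasDerivAt_line (x u : E) (c : ℝ) :
    HasDerivAt (fun t : ℝ => x + (c * t) • u) (c • u) 0 := by
  simpa using! (((hasDerivAt_id (0 : ℝ)).const_mul c).smul_const u).const_add x

theorem hasDerivAt_line' (x u : E) : HasDerivAt (fun t : ℝ => x + t • u) u 0 := by
  simpa using! ((hasDerivAt_id (0 : ℝ)).smul_const u).const_add x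

theorem hasDerivAt_comp_line {L : E → ℝ} (hL : Differentiable ℝ L) (x u : E) :
    HasDerivAt (fun t : ℝ => L (x + t • u)) (fderiv ℝ L x u) 0 := by
  have h : HasFDerivAt L (fderiv ℝ L x) (x + (0 : ℝ) • u) := by
    simpa using (hL x).hasFDerivAt
  exact h.comp_hasDerivAt (0 : ℝ) (hasDerivAt_line' x u)

theorem hasDerivAt_fderiv_line {L : E → ℝ} (hL : Differentiable ℝ (fderiv ℝ L)) (x u : E) :
    HasDerivAt (fun t : ℝ => fderiv ℝ L (x + t • u) u) (hessQuad L x u) 0 := by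
  have h : HasFDerivAt (fderiv ℝ L) (fderiv ℝ (fderiv ℝ L) x) (x + (0 : ℝ) • u) := by
    simpa using (hL x).hasFDerivAt
  have h1 : HasDerivAt (fun t : ℝ => fderiv ℝ L (x + t • u)) (fderiv ℝ (fderiv ℝ L) x u) 0 :=
    h.comp_hasDerivAt (0 : ℝ) (hasDerivAt_line' x u)
  have h2 := h1.clm_apply (hasDerivAt_const (0 : ℝ) u)
  rw [map_zero, add_zero] at h2
  exact h2

/-- A straight line in the factors becomes a parabola in the product. Its acceleration produces the
gradient term in the Hessian of the factored loss. -/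
theorem hasDerivAt_fderiv_parabola {L : E → ℝ} (hL : Differentiable ℝ (fderiv ℝ L)) (x u v : E) :
    HasDerivAt (fun t : ℝ => fderiv ℝ L (x + t • u + (t * t) • v) (u + (2 * t) • v))
      (hessQuad L x u + 2 * fderiv ℝ L x v) 0 := by
  have h : HasFDerivAt (fderiv ℝ L) (fderiv ℝ (fderiv ℝ L) x)
      (x + (0 : ℝ) • u + ((0 : ℝ) * 0) • v) := by
    simpa using (hL x).hasFDerivAt
  have h1 : HasDerivAt (fun t : ℝ => fderiv ℝ L (x + t • u + (t * t) • v))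
      (fderiv ℝ (fderiv ℝ L) x u) 0 :=
    h.comp_hasDerivAt (0 : ℝ) (hasDerivAt_parabola x u v)
  have h2 := h1.clm_apply (hasDerivAt_line u v 2)
  simp only [mul_zero, zero_smul, add_zero, map_smul, smul_eq_mul] at h2
  exact h2

end Line

/-- First-order optimality of a global minimizer of the regularized loss. -/
theorem IsGlobalMinimizer.neg_fderiv_le {f : Matrix (Fin m) (Fin n) ℝ → ℝ} {lam : ℝ}
    {Xs : Matrix (Fin m) (Fin n) ℝ} (hf : Differentiable ℝ f) (hlam : 0 ≤ lam)
    (hmin : IsGlobalMinimizer (fullLoss f lam) Xs) (Y : Matrix (Fin m) (Fin n) ℝ) :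
    -fderiv ℝ f Xs (Y - Xs) ≤ lam * (nuclearNorm Y - nuclearNorm Xs) := by
  have h2 := hasDerivAt_comp_line hf Xs (Y - Xs)
  have h3 := h2.tendsto_slope_zero_right
  have h4 : -(lam * (nuclearNorm Y - nuclearNorm Xs)) ≤ fderiv ℝ f Xs (Y - Xs) := by
    -- Every right difference quotient of f obeys the bound: minimality of X⋆ compares f with
    -- λ‖·‖_*, and convexity bounds the growth of the latter linearly.
    refine ge_of_tendsto h3 ?_
    filter_upwards [Ioc_mem_nhdsGT (show (0 : ℝ) < 1 by norm_num)] with t ht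
    have h5 := hmin (Xs + t • (Y - Xs))
    have h6 := mul_le_mul_of_nonneg_left (nuclearNorm_convex Xs Y ht.1.le ht.2) hlam
    simp only [fullLoss] at h5
    simp only [zero_add, zero_smul, add_zero, smul_eq_mul]
    rw [inv_mul_eq_div, le_div_iff₀ ht.1]
    linarith
  linarith

/-! ### Gradient and Hessian of the factored loss. -/

theorem isBoundedBilinearMap_mul_transpose :
    IsBoundedBilinearMap ℝ
      (fun p : Matrix (Fin m) (Fin k) ℝ × Matrix (Fin n) (Fin k) ℝ => p.1 * p.2ᵀ) where
  add_left x₁ x₂ y := Matrix.add_mul _ _ _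
  smul_left c x y := Matrix.smul_mul _ _ _
  add_right x y₁ y₂ := by simp [Matrix.mul_add]
  smul_right c x y := by simp
  bound := ⟨1, one_pos, fun x y => by
    rw [one_mul]
    refine (Matrix.frobenius_norm_mul _ _).trans ?_
    rw [Matrix.frobenius_norm_transpose]⟩

theorem isBoundedBilinearMap_ip_add_ip :
    IsBoundedBilinearMap ℝ
      (fun p : (Matrix (Fin m) (Fin k) ℝ × Matrix (Fin n) (Fin k) ℝ) ×
        (Matrix (Fin m) (Fin k) ℝ × Matrix (Fin n) (Fin k) ℝ) =>
        ip p.1.1 p.2.1 + ip p.1.2 p.2.2) where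
  add_left x₁ x₂ y := by simp [ip_add_left]; ring
  smul_left c x y := by simp [ip_smul_left]; ring
  add_right x y₁ y₂ := by simp [ip_add_right]; ring
  smul_right c x y := by simp [ip_smul_right]; ring
  bound := ⟨2, two_pos, fun x y => by
    refine (norm_add_le _ _).trans ?_
    rw [Real.norm_eq_abs, Real.norm_eq_abs]
    have h1 := (abs_ip_le x.1 y.1).trans
      (mul_le_mul (norm_fst_le x) (norm_fst_le y) (norm_nonneg _) (norm_nonneg _))
    have h2 := (abs_ip_le x.2 y.2).trans
      (mul_le_mul (norm_snd_le x) (norm_snd_le y) (norm_nonneg _) (norm_nonneg _))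
    linarith⟩

theorem hasFDerivAt_loraLoss {f : Matrix (Fin m) (Fin n) ℝ → ℝ} (hf : Differentiable ℝ f)
    (lam : ℝ) (p : Matrix (Fin m) (Fin k) ℝ × Matrix (Fin n) (Fin k) ℝ) :
    HasFDerivAt (loraLoss k f lam)
      ((fderiv ℝ f (p.1 * p.2ᵀ)).comp (isBoundedBilinearMap_mul_transpose.deriv p)
        + lam • isBoundedBilinearMap_ip_add_ip.toContinuousLinearMap p) p := by
  have h1 := ((hf (p.1 * p.2ᵀ)).hasFDerivAt).comp p
    (isBoundedBilinearMap_mul_transpose.hasFDerivAt p)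
  have h2 := HasFDerivAt.comp (f := fun q => (q, q)) p
    (isBoundedBilinearMap_ip_add_ip.hasFDerivAt (p, p))
    ((hasFDerivAt_id (𝕜 := ℝ) p).prodMk (hasFDerivAt_id p))
  have h3 := h1.add (h2.const_mul (lam / 2))
  have h4 : loraLoss k f lam = fun p => f (p.1 * p.2ᵀ) + lam / 2 * (ip p.1 p.1 + ip p.2 p.2) := by
    ext q
    simp [loraLoss, norm_sq_eq_ip]
  rw [h4]
  refine h3.congr_fderiv ?_
  refine ContinuousLinearMap.ext fun u => ?_
  change fderiv ℝ f (p.1 * p.2ᵀ) (p.1 * u.2ᵀ + u.1 * p.2ᵀ) +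
      lam / 2 * (ip p.1 u.1 + ip p.2 u.2 + (ip u.1 p.1 + ip u.2 p.2)) =
    fderiv ℝ f (p.1 * p.2ᵀ) (p.1 * u.2ᵀ + u.1 * p.2ᵀ) + lam * (ip p.1 u.1 + ip p.2 u.2)
  rw [ip_comm u.1, ip_comm u.2]
  ring

theorem gradPair_loraLoss {f : Matrix (Fin m) (Fin n) ℝ → ℝ} (hf : Differentiable ℝ f) (lam : ℝ)
    (A U : Matrix (Fin m) (Fin k) ℝ) (B V : Matrix (Fin n) (Fin k) ℝ) :
    gradPair (loraLoss k f lam) (A, B) (U, V) =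
      fderiv ℝ f (A * Bᵀ) (A * Vᵀ + U * Bᵀ) + lam * (ip A U + ip B V) := by
  rw [gradPair, (hasFDerivAt_loraLoss hf lam (A, B)).fderiv]
  rfl

theorem hessQuad_loraLoss {f : Matrix (Fin m) (Fin n) ℝ → ℝ} (hf : TwiceDifferentiable f)
    (lam : ℝ) (A U : Matrix (Fin m) (Fin k) ℝ) (B V : Matrix (Fin n) (Fin k) ℝ) :
    hessQuad (loraLoss k f lam) (A, B) (U, V) =
      hessQuad f (A * Bᵀ) (A * Vᵀ + U * Bᵀ) + 2 * fderiv ℝ f (A * Bᵀ) (U * Vᵀ)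
        + lam * (‖U‖ ^ 2 + ‖V‖ ^ 2) := by
  have hd : Differentiable ℝ (fderiv ℝ (loraLoss k f lam)) := by
    have : fderiv ℝ (loraLoss k f lam) = fun p =>
        (fderiv ℝ f (p.1 * p.2ᵀ)).comp (isBoundedBilinearMap_mul_transpose.deriv p)
          + lam • isBoundedBilinearMap_ip_add_ip.toContinuousLinearMap p :=
      funext fun p => (hasFDerivAt_loraLoss hf.1 lam p).fderiv
    rw [this]
    have h1 : Differentiable ℝ fun p : Matrix (Fin m) (Fin k) ℝ × Matrix (Fin n) (Fin k) ℝ =>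
        (fderiv ℝ f (p.1 * p.2ᵀ)).comp (isBoundedBilinearMap_mul_transpose.deriv p) :=
      Differentiable.clm_comp
        (hf.2.comp fun p => isBoundedBilinearMap_mul_transpose.differentiableAt p)
        isBoundedBilinearMap_mul_transpose.isBoundedLinearMap_deriv.differentiable
    have h2 : Differentiable ℝ fun p : Matrix (Fin m) (Fin k) ℝ × Matrix (Fin n) (Fin k) ℝ =>
        lam • isBoundedBilinearMap_ip_add_ip.toContinuousLinearMap p :=
      (ContinuousLinearMap.differentiable _).const_smul lam
    exact h1.add h2
  have h1 := hasDerivAt_fderiv_line hd (A, B) (U, V)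
  let M := A * Vᵀ + U * Bᵀ
  let N := U * Vᵀ
  have hprod : ∀ t : ℝ, (A + t • U) * (B + t • V)ᵀ = A * Bᵀ + t • M + (t * t) • N := by
    intro t
    simp only [M, N, transpose_add, transpose_smul, Matrix.add_mul, Matrix.mul_add,
      Matrix.smul_mul, Matrix.mul_smul, smul_smul, smul_add]
    abel
  have hdir : ∀ t : ℝ, (A + t • U) * Vᵀ + U * (B + t • V)ᵀ = M + (2 * t) • N := by
    intro t
    simp only [M, N, transpose_add, transpose_smul, Matrix.add_mul, Matrix.mul_add,
      Matrix.smul_mul, Matrix.mul_smul, two_mul, add_smul]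
    abel
  have hfun : (fun t : ℝ => fderiv ℝ (loraLoss k f lam) ((A, B) + t • (U, V)) (U, V)) =
      fun t : ℝ => fderiv ℝ f (A * Bᵀ + t • M + (t * t) • N) (M + (2 * t) • N)
        + lam * ((ip A U + ip B V) + t * (‖U‖ ^ 2 + ‖V‖ ^ 2)) := by
    ext t
    have := gradPair_loraLoss hf.1 lam (A + t • U) U (B + t • V) V
    rw [gradPair, hprod, hdir] at this
    refine this.trans ?_
    simp only [ip_add_left, ip_smul_left, norm_sq_eq_ip]
    ring
  have h5 := hasDerivAt_fderiv_parabola hf.2 (A * Bᵀ) M N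
  have h6 : HasDerivAt (fun t : ℝ => lam * ((ip A U + ip B V) + t * (‖U‖ ^ 2 + ‖V‖ ^ 2)))
      (lam * (‖U‖ ^ 2 + ‖V‖ ^ 2)) 0 := by
    simpa using! (((hasDerivAt_id (0 : ℝ)).mul_const (‖U‖ ^ 2 + ‖V‖ ^ 2)).const_add
      (ip A U + ip B V)).const_mul lam
  refine h1.unique ((h5.add h6).congr_of_eventuallyEq (Filter.Eventually.of_forall fun t => ?_))
  exact congrFun hfun t

theorem ip_zero_right (A : Matrix (Fin m) (Fin n) ℝ) : ip A 0 = 0 := by simp [ip]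

theorem ip_mul_transpose (G : Matrix (Fin m) (Fin n) ℝ) (A : Matrix (Fin m) (Fin k) ℝ)
    (V : Matrix (Fin n) (Fin k) ℝ) : ip G (A * Vᵀ) = ip (Gᵀ * A) V := by
  rw [ip_comm, ip_mul_right, ip_mul_left, transpose_transpose, transpose_transpose]

theorem ip_mul_transpose' (G : Matrix (Fin m) (Fin n) ℝ) (U : Matrix (Fin m) (Fin k) ℝ)
    (B : Matrix (Fin n) (Fin k) ℝ) : ip G (U * Bᵀ) = ip (G * B) U := by
  rw [ip_mul_right]

theorem eq_zero_of_forall_ip {M : Matrix (Fin m) (Fin n) ℝ} (h : ∀ U, ip M U = 0) : M = 0 := by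
  have := h M
  rw [← norm_sq_eq_ip] at this
  simpa using this

theorem norm_sq_vecMulVec (u : Fin m → ℝ) (v : Fin n → ℝ) :
    ‖vecMulVec u v‖ ^ 2 = (u ⬝ᵥ u) * (v ⬝ᵥ v) := by
  rw [norm_sq_eq_ip, ip_vecMulVec, vecMulVec_mulVec, dotProduct_comm]
  simp [mul_comm, dotProduct_comm]

theorem eq_zero_of_dotProduct_self {v : Fin n → ℝ} (h : v ⬝ᵥ v = 0) : v = 0 :=
  dotProduct_self_eq_zero.mp h

theorem dotProduct_self_pos {v : Fin n → ℝ} (h : v ≠ 0) : 0 < v ⬝ᵥ v :=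
  lt_of_le_of_ne (dotProduct_self_nonneg' v) fun h0 => h (eq_zero_of_dotProduct_self h0.symm)

theorem vecMulVec_zero_right (u : Fin m → ℝ) : vecMulVec u (0 : Fin n → ℝ) = 0 := by
  ext i j
  simp [vecMulVec_apply]

theorem hessQuad_smul {E : Type*} [NormedAddCommGroup E] [NormedSpace ℝ E] (L : E → ℝ) (x u : E)
    (t : ℝ) : hessQuad L x (t • u) = t ^ 2 * hessQuad L x u := by
  simp [hessQuad]
  ring

/-! ### Stationarity in matrix form. -/

/-- The stationarity conditions at a factorization `(A, B)`, with `G` the gradient of the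
unregularized loss and `q` its Hessian quadratic form at `A Bᵀ`. -/
structure FactorSOSP (lam : ℝ) (G : Matrix (Fin m) (Fin n) ℝ) (q : Matrix (Fin m) (Fin n) ℝ → ℝ)
    (A : Matrix (Fin m) (Fin k) ℝ) (B : Matrix (Fin n) (Fin k) ℝ) : Prop where
  left : G * B = -(lam • A)
  right : Gᵀ * A = -(lam • B)
  hess : ∀ (U : Matrix (Fin m) (Fin k) ℝ) (V : Matrix (Fin n) (Fin k) ℝ),
    0 ≤ q (A * Vᵀ + U * Bᵀ) + 2 * ip G (U * Vᵀ) + lam * (‖U‖ ^ 2 + ‖V‖ ^ 2)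
  smul : ∀ t M, q (t • M) = t ^ 2 * q M

theorem IsSOSP.factorSOSP {f : Matrix (Fin m) (Fin n) ℝ → ℝ} (hf : TwiceDifferentiable f)
    {lam : ℝ} {A : Matrix (Fin m) (Fin k) ℝ} {B : Matrix (Fin n) (Fin k) ℝ}
    (h : IsSOSP (loraLoss k f lam) (A, B)) {G : Matrix (Fin m) (Fin n) ℝ}
    (hG : ∀ H, fderiv ℝ f (A * Bᵀ) H = ip G H) :
    FactorSOSP lam G (hessQuad f (A * Bᵀ)) A B where
  left := by
    rw [eq_neg_iff_add_eq_zero]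
    refine eq_zero_of_forall_ip fun U => ?_
    have := h.1 (U, 0)
    rw [gradPair_loraLoss hf.1, hG] at this
    simp only [transpose_zero, Matrix.mul_zero, zero_add, ip_zero_right, add_zero] at this
    rw [ip_add_left, ip_smul_left, ← ip_mul_transpose', this]
  right := by
    rw [eq_neg_iff_add_eq_zero]
    refine eq_zero_of_forall_ip fun V => ?_
    have := h.1 (0, V)
    rw [gradPair_loraLoss hf.1, hG] at this
    simp only [Matrix.zero_mul, add_zero, ip_zero_right, zero_add] at this
    rw [ip_add_left, ip_smul_left, ← ip_mul_transpose, this]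
  hess U V := by
    have := h.2 (U, V)
    rw [hessQuad_loraLoss hf, hG] at this
    exact this
  smul t M := hessQuad_smul f _ M t

section Factor

variable {lam : ℝ} {G : Matrix (Fin m) (Fin n) ℝ} {q : Matrix (Fin m) (Fin n) ℝ → ℝ}
  {A : Matrix (Fin m) (Fin k) ℝ} {B : Matrix (Fin n) (Fin k) ℝ}

/-- Stationarity gives ⟨G, ABᵀ⟩ = -λ‖A‖² = -λ‖B‖². Averaging the two and applying the factorization
bound for the nuclear norm suffices. -/
theorem FactorSOSP.ip_le (h : FactorSOSP lam G q A B) (hlam : 0 ≤ lam) :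
    ip G (A * Bᵀ) ≤ -(lam * nuclearNorm (A * Bᵀ)) := by
  have h1 : ip G (A * Bᵀ) = -(lam * ‖A‖ ^ 2) := by
    rw [ip_mul_transpose', h.left, ip_neg_left, ip_smul_left, norm_sq_eq_ip]
  have h2 : ip G (A * Bᵀ) = -(lam * ‖B‖ ^ 2) := by
    rw [ip_mul_transpose, h.right, ip_neg_left, ip_smul_left, norm_sq_eq_ip]
  have h4 := mul_le_mul_of_nonneg_left (two_mul_nuclearNorm_mul_le A B) hlam
  linarith

/-- Evaluate AᵀGB with each of the two stationarity equations and cancel λ. -/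
theorem FactorSOSP.balanced (h : FactorSOSP lam G q A B) (hlam : lam ≠ 0) :
    Aᵀ * A = Bᵀ * B := by
  have h1 : Aᵀ * (G * B) = (Gᵀ * A)ᵀ * B := by
    rw [transpose_mul, transpose_transpose, Matrix.mul_assoc]
  rw [h.left, h.right] at h1
  simp only [Matrix.mul_neg, Matrix.mul_smul, transpose_neg, transpose_smul, Matrix.neg_mul,
    Matrix.smul_mul, neg_inj] at h1
  exact smul_right_injective _ hlam h1

/-! ### Rank-deficient factorizations. -/

theorem mulVec_eq_zero_of_gram {A : Matrix (Fin m) (Fin k) ℝ} {w : Fin k → ℝ}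
    (h : (Aᵀ * A) *ᵥ w = 0) : A *ᵥ w = 0 := by
  apply eq_zero_of_dotProduct_self
  rw [dotProduct_mulVec, ← mulVec_transpose, mulVec_mulVec, h, zero_dotProduct]

/-- If both Gram matrices were invertible, Aᵀ(ABᵀ)B would have rank k, more than the rank of ABᵀ. -/
theorem exists_kernel_of_rank_lt (h : (A * Bᵀ).rank < k) :
    ∃ w : Fin k → ℝ, w ≠ 0 ∧ (A *ᵥ w = 0 ∨ B *ᵥ w = 0) := by
  have hdet : (Aᵀ * A).det = 0 ∨ (Bᵀ * B).det = 0 := by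
    by_contra! hne
    have hu : IsUnit ((Aᵀ * A) * (Bᵀ * B)) := by
      rw [Matrix.isUnit_iff_isUnit_det, det_mul]
      exact (mul_ne_zero hne.1 hne.2).isUnit
    have h1 := rank_of_isUnit _ hu
    have h2 : (Aᵀ * A) * (Bᵀ * B) = Aᵀ * (A * Bᵀ) * B := by simp only [Matrix.mul_assoc]
    rw [h2, Fintype.card_fin] at h1
    have h3 := (rank_mul_le_left (Aᵀ * (A * Bᵀ)) B).trans (rank_mul_le_right Aᵀ (A * Bᵀ))
    omega
  rcases hdet with hd | hd
  · obtain ⟨w, hw, h0⟩ := Matrix.exists_mulVec_eq_zero_iff.mpr hd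
    exact ⟨w, hw, Or.inl (mulVec_eq_zero_of_gram h0)⟩
  · obtain ⟨w, hw, h0⟩ := Matrix.exists_mulVec_eq_zero_iff.mpr hd
    exact ⟨w, hw, Or.inr (mulVec_eq_zero_of_gram h0)⟩

theorem vecMulVec_mul_transpose (u : Fin m → ℝ) (w : Fin k → ℝ) (B : Matrix (Fin n) (Fin k) ℝ) :
    vecMulVec u w * Bᵀ = vecMulVec u (B *ᵥ w) := by
  rw [vecMulVec_mul, vecMul_transpose]

theorem mul_transpose_vecMulVec (v : Fin n → ℝ) (w : Fin k → ℝ) (A : Matrix (Fin m) (Fin k) ℝ) :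
    A * (vecMulVec v w)ᵀ = vecMulVec (A *ᵥ w) v := by
  rw [transpose_vecMulVec, mul_vecMulVec]

theorem vecMulVec_mul_transpose_vecMulVec (u : Fin m → ℝ) (v : Fin n → ℝ) (a b : Fin k → ℝ) :
    vecMulVec u a * (vecMulVec v b)ᵀ = (a ⬝ᵥ b) • vecMulVec u v := by
  rw [transpose_vecMulVec, vecMulVec_mul_vecMulVec, vecMulVec_smul]

/-- The second-order condition along rank-one directions. -/
theorem FactorSOSP.rank_one (h : FactorSOSP lam G q A B) (u : Fin m → ℝ) (v : Fin n → ℝ)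
    (a b : Fin k → ℝ) :
    0 ≤ q (vecMulVec (A *ᵥ b) v + vecMulVec u (B *ᵥ a)) + 2 * (a ⬝ᵥ b) * (u ⬝ᵥ (G *ᵥ v))
      + lam * ((u ⬝ᵥ u) * (a ⬝ᵥ a) + (v ⬝ᵥ v) * (b ⬝ᵥ b)) := by
  have := h.hess (vecMulVec u a) (vecMulVec v b)
  rw [vecMulVec_mul_transpose, mul_transpose_vecMulVec, vecMulVec_mul_transpose_vecMulVec,
    norm_sq_vecMulVec, norm_sq_vecMulVec, ip_smul_right, ip_vecMulVec] at this
  linarith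

/-- As t → 0 the linear term dominates. This removes the curvature term when λ = 0. -/
theorem nonneg_of_forall_sq {a b : ℝ} (h : ∀ t : ℝ, 0 < t → 0 ≤ t ^ 2 * a + t * b) : 0 ≤ b := by
  by_contra! hb
  have ht : 0 < -b / (2 * (|a| + 1)) := by
    have := abs_nonneg a
    have : 0 < -b := by linarith
    positivity
  have h1 := h _ ht
  have h2 : 0 ≤ (-b / (2 * (|a| + 1))) * a + b := by
    have h3 : (-b / (2 * (|a| + 1))) ^ 2 * a + (-b / (2 * (|a| + 1))) * b =
      (-b / (2 * (|a| + 1))) * ((-b / (2 * (|a| + 1))) * a + b) := by ring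
    rw [h3] at h1
    exact nonneg_of_mul_nonneg_right h1 ht
  have h4 : (-b / (2 * (|a| + 1))) * a ≤ (-b / (2 * (|a| + 1))) * (|a| + 1) :=
    mul_le_mul_of_nonneg_left (by linarith [le_abs_self a]) ht.le
  have h5 : (-b / (2 * (|a| + 1))) * (|a| + 1) = -b / 2 := by
    have : |a| + 1 ≠ 0 := by positivity
    field_simp
  linarith

/-- If the factorization is rank deficient, the gradient has operator norm at most `lam`. -/
theorem FactorSOSP.opNormLE_of_rank_lt (h : FactorSOSP lam G q A B) (hr : (A * Bᵀ).rank < k) :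
    OpNormLE lam G := by
  obtain ⟨w, hw, hker⟩ := exists_kernel_of_rank_lt hr
  have hc := dotProduct_self_pos hw
  have hq0 : q 0 = 0 := by simpa using h.smul 0 0
  intro u v
  rcases eq_or_ne lam 0 with rfl | hlam
  · rw [zero_mul]
    -- Without weight decay the factors need not be balanced, so only one of them is known to kill
    -- w. Scaling the vector attached to the surviving curvature term by t makes that term quadratic
    -- in t while the gradient term stays linear.
    have hneg : 0 ≤ -(2 * (w ⬝ᵥ w) * (u ⬝ᵥ (G *ᵥ v))) := by
      rcases hker with h0 | h0
      · refine nonneg_of_forall_sq (a := q (vecMulVec (-u) (B *ᵥ w))) fun t _ => ?_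
        have := h.rank_one (-(t • u)) v w w
        rw [h0, zero_vecMulVec, zero_add, ← smul_neg, smul_vecMulVec, h.smul] at this
        simp only [smul_dotProduct, neg_dotProduct, smul_eq_mul] at this
        linarith
      · refine nonneg_of_forall_sq (a := q (vecMulVec (A *ᵥ w) v)) fun t _ => ?_
        have := h.rank_one (-u) (t • v) w w
        rw [h0, vecMulVec_zero_right, add_zero, vecMulVec_smul, h.smul, mulVec_smul] at this
        simp only [dotProduct_smul, neg_dotProduct, smul_eq_mul] at this
        linarith
    nlinarith
  -- Balancedness makes w a common kernel vector, so the curvature term vanishes outright.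
  · have hb := h.balanced hlam
    have hAB : A *ᵥ w = 0 ∧ B *ᵥ w = 0 := by
      rcases hker with h0 | h0
      · exact ⟨h0, mulVec_eq_zero_of_gram (by rw [← hb, ← mulVec_mulVec, h0, mulVec_zero])⟩
      · exact ⟨mulVec_eq_zero_of_gram (by rw [hb, ← mulVec_mulVec, h0, mulVec_zero]), h0⟩
    have := h.rank_one (-u) v w w
    rw [hAB.1, hAB.2, zero_vecMulVec, vecMulVec_zero_right, add_zero, hq0] at this
    simp only [neg_dotProduct, dotProduct_neg, neg_neg] at this
    have h2 : 0 ≤ (w ⬝ᵥ w) * (lam * (u ⬝ᵥ u + v ⬝ᵥ v) - 2 * (u ⬝ᵥ (G *ᵥ v))) := by linarith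
    linarith [nonneg_of_mul_nonneg_right h2 hc]

/-! ### Action of the gradient on the singular vectors. -/

/-- A Gram matrix whose square has `p` as an eigenvector has `p` as an eigenvector. -/
theorem gram_mulVec_of_sq {A : Matrix (Fin m) (Fin k) ℝ} {p : Fin m → ℝ} {s : ℝ} (hs : 0 < s)
    (h : (A * Aᵀ * (A * Aᵀ)) *ᵥ p = s ^ 2 • p) : (A * Aᵀ) *ᵥ p = s • p := by
  set x := (A * Aᵀ) *ᵥ p - s • p with hx
  -- Factor M² - s² as (M + s)(M - s) with M = AAᵀ; M + s is positive definite, so x = (M - s)p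
  -- vanishes.
  have h1 : (A * Aᵀ) *ᵥ x + s • x = 0 := by
    rw [hx, mulVec_sub, mulVec_mulVec, h, mulVec_smul, smul_sub, smul_smul, ← sq]
    abel
  have h2 : x ⬝ᵥ ((A * Aᵀ) *ᵥ x) = (Aᵀ *ᵥ x) ⬝ᵥ (Aᵀ *ᵥ x) := by
    rw [← mulVec_mulVec, dotProduct_mulVec, ← mulVec_transpose]
  have h3 : x ⬝ᵥ ((A * Aᵀ) *ᵥ x + s • x) = 0 := by rw [h1, dotProduct_zero]
  rw [dotProduct_add, h2, dotProduct_smul, smul_eq_mul] at h3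
  have h4 := dotProduct_self_nonneg' (Aᵀ *ᵥ x)
  have h5 := dotProduct_self_nonneg' x
  have h6 : x = 0 := eq_zero_of_dotProduct_self (by nlinarith)
  exact sub_eq_zero.mp h6

variable {X : Matrix (Fin m) (Fin n) ℝ} {P : Matrix (Fin m) (Fin l) ℝ} {s : Fin l → ℝ}
  {Q : Matrix (Fin n) (Fin l) ℝ}

theorem col_mul_diagonal (P : Matrix (Fin m) (Fin l) ℝ) (s : Fin l → ℝ) (i : Fin l) :
    (P * diagonal s)ᵀ i = s i • Pᵀ i := by
  ext j
  simp [mul_comm]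

theorem IsSVD.transpose_eq (h : IsSVD X P s Q) : Xᵀ = Q * diagonal s * Pᵀ := by
  rw [h.eq]
  simp [transpose_mul, Matrix.mul_assoc]

theorem IsSVD.mulVec_right (h : IsSVD X P s Q) (i : Fin l) : X *ᵥ Qᵀ i = s i • Pᵀ i := by
  rw [← transpose_mul_apply, h.eq, Matrix.mul_assoc, h.right, Matrix.mul_one, col_mul_diagonal]

theorem IsSVD.mulVec_left (h : IsSVD X P s Q) (i : Fin l) : Xᵀ *ᵥ Pᵀ i = s i • Qᵀ i := by
  rw [← transpose_mul_apply, h.transpose_eq, Matrix.mul_assoc, h.left, Matrix.mul_one,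
    col_mul_diagonal]

/-- By balancedness (AAᵀ)² = XXᵀ, which has the left singular vectors as eigenvectors. Keeping λ on
both sides covers λ = 0, where balancedness is unavailable. -/
theorem FactorSOSP.gram_left (h : FactorSOSP lam G q A B) (hX : IsSVD (A * Bᵀ) P s Q)
    (i : Fin l) : lam • ((A * Aᵀ) *ᵥ Pᵀ i) = lam • (s i • Pᵀ i) := by
  rcases eq_or_ne lam 0 with rfl | hlam
  · simp
  rw [gram_mulVec_of_sq (hX.pos i)]
  have h1 : A * Aᵀ * (A * Aᵀ) = A * Bᵀ * (A * Bᵀ)ᵀ := by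
    rw [transpose_mul, transpose_transpose, Matrix.mul_assoc, ← Matrix.mul_assoc Aᵀ,
      h.balanced hlam]
    simp only [Matrix.mul_assoc]
  rw [h1, ← mulVec_mulVec, hX.mulVec_left, mulVec_smul, hX.mulVec_right, smul_smul, sq]

theorem FactorSOSP.gram_right (h : FactorSOSP lam G q A B) (hX : IsSVD (A * Bᵀ) P s Q)
    (i : Fin l) : lam • ((B * Bᵀ) *ᵥ Qᵀ i) = lam • (s i • Qᵀ i) := by
  rcases eq_or_ne lam 0 with rfl | hlam
  · simp
  rw [gram_mulVec_of_sq (hX.pos i)]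
  have h1 : B * Bᵀ * (B * Bᵀ) = (A * Bᵀ)ᵀ * (A * Bᵀ) := by
    rw [transpose_mul, transpose_transpose, Matrix.mul_assoc, ← Matrix.mul_assoc Bᵀ,
      ← h.balanced hlam]
    simp only [Matrix.mul_assoc]
  rw [h1, ← mulVec_mulVec, hX.mulVec_right, mulVec_smul, hX.mulVec_left, smul_smul, sq]

theorem FactorSOSP.mulVec_right (h : FactorSOSP lam G q A B) (hX : IsSVD (A * Bᵀ) P s Q)
    (i : Fin l) : G *ᵥ Qᵀ i = -(lam • Pᵀ i) := by
  have h1 : s i • (G *ᵥ Qᵀ i) = s i • (-(lam • Pᵀ i)) := by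
    rw [← mulVec_smul, ← hX.mulVec_left, mulVec_mulVec, transpose_mul, transpose_transpose,
      ← Matrix.mul_assoc, h.left, Matrix.neg_mul, Matrix.smul_mul, neg_mulVec, smul_mulVec,
      h.gram_left hX, smul_neg, smul_comm]
  exact smul_right_injective _ (hX.pos i).ne' h1

theorem FactorSOSP.mulVec_left (h : FactorSOSP lam G q A B) (hX : IsSVD (A * Bᵀ) P s Q)
    (i : Fin l) : Gᵀ *ᵥ Pᵀ i = -(lam • Qᵀ i) := by
  have h1 : s i • (Gᵀ *ᵥ Pᵀ i) = s i • (-(lam • Qᵀ i)) := by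
    rw [← mulVec_smul, ← hX.mulVec_right, mulVec_mulVec,
      ← Matrix.mul_assoc, h.right, Matrix.neg_mul, Matrix.smul_mul, neg_mulVec, smul_mulVec,
      h.gram_right hX, smul_neg, smul_comm]
  exact smul_right_injective _ (hX.pos i).ne' h1

theorem FactorSOSP.mul_right (h : FactorSOSP lam G q A B) (hX : IsSVD (A * Bᵀ) P s Q) :
    G * Q = -(lam • P) := by
  apply transpose_injective
  ext1 i
  rw [transpose_mul_apply, h.mulVec_right hX]
  exact fun j => rfl

theorem FactorSOSP.mul_left (h : FactorSOSP lam G q A B) (hX : IsSVD (A * Bᵀ) P s Q) :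
    Gᵀ * P = -(lam • Q) := by
  apply transpose_injective
  ext1 i
  rw [transpose_mul_apply, h.mulVec_left hX]
  exact fun j => rfl

/-! ### Curvature bound on the complement of the singular spaces. -/

/-- Smoothness of the form `q` along directions `U X + X V` with rank-one unit `U`, `V`. -/
def RankOneSmooth (β : ℝ) (X : Matrix (Fin m) (Fin n) ℝ) (q : Matrix (Fin m) (Fin n) ℝ → ℝ) :
    Prop :=
  ∀ (U : Matrix (Fin m) (Fin m) ℝ) (V : Matrix (Fin n) (Fin n) ℝ),
    U.rank = 1 → ‖U‖ = 1 → V.rank = 1 → ‖V‖ = 1 → q (U * X + X * V) ≤ β * ‖U * X + X * V‖ ^ 2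

theorem norm_vecMulVec_eq_one {u : Fin m → ℝ} {v : Fin n → ℝ} (hu : u ⬝ᵥ u = 1)
    (hv : v ⬝ᵥ v = 1) : ‖vecMulVec u v‖ = 1 := by
  have := norm_sq_vecMulVec u v
  rw [hu, hv, mul_one] at this
  exact (pow_eq_one_iff_of_nonneg (norm_nonneg _) two_ne_zero).mp this

theorem eq_zero_of_rank_eq_zero {X : Matrix (Fin m) (Fin n) ℝ} (h0 : X.rank = 0) : X = 0 := by
  obtain ⟨P, s, Q, h⟩ := exists_isSVD X h0
  rw [h.eq]
  ext i j
  simp [Matrix.mul_apply]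

theorem rank_vecMulVec_eq_one {u v : Fin m → ℝ} (hu : u ⬝ᵥ u = 1)
    (hv : v ⬝ᵥ v = 1) : (vecMulVec u v).rank = 1 := by
  have h1 := rank_vecMulVec_le u v
  have h2 : (vecMulVec u v).rank ≠ 0 := by
    intro h0
    have h3 := norm_vecMulVec_eq_one hu hv
    rw [eq_zero_of_rank_eq_zero h0, norm_zero] at h3
    exact zero_ne_one h3
  omega

/-- The second-order condition in directions orthogonal to the singular vectors. -/
theorem FactorSOSP.dotProduct_le {β : ℝ} (h : FactorSOSP lam G q A B)
    (hX : IsSVD (A * Bᵀ) P s Q) (hβ : RankOneSmooth β (A * Bᵀ) q) (i : Fin l)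
    {u : Fin m → ℝ} {v : Fin n → ℝ} (hu : u ⬝ᵥ u = 1) (hv : v ⬝ᵥ v = 1)
    (hPu : Pᵀ *ᵥ u = 0) :
    u ⬝ᵥ (G *ᵥ v) ≤ lam + β * s i := by
  set p := Pᵀ i with hp
  set o := Qᵀ i with ho
  have hs := hX.pos i
  have hpp : p ⬝ᵥ p = 1 := col_dotProduct_self hX.left i
  have hoo : o ⬝ᵥ o = 1 := col_dotProduct_self hX.right i
  have hpu : p ⬝ᵥ u = 0 := congrFun hPu i
  have hXo : (A * Bᵀ) *ᵥ o = s i • p := hX.mulVec_right i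
  have hXp : (A * Bᵀ)ᵀ *ᵥ p = s i • o := hX.mulVec_left i
  -- The two rank-one pieces are orthogonal because p ⟂ u, so ‖N‖² = 2; orthogonality of v and o is
  -- not required. Up to the factor s i, N has the form UX + XV with rank-one unit U and V.
  set N := vecMulVec p v + vecMulVec (-u) o with hN
  have hNorm : ‖N‖ ^ 2 = 2 := by
    have h1 := norm_sq_vecMulVec p v
    have h2 := norm_sq_vecMulVec (-u) o
    have h3 : ip (vecMulVec p v) (vecMulVec (-u) o) = 0 := by
      rw [ip_vecMulVec, vecMulVec_mulVec, neg_dotProduct]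
      simp [dotProduct_comm u p, hpu]
    rw [hpp, hv, mul_one] at h1
    rw [neg_dotProduct, dotProduct_neg, neg_neg, hu, hoo, mul_one] at h2
    rw [norm_sq_eq_ip] at h1 h2 ⊢
    rw [hN, ip_add_left, ip_add_right, ip_add_right, h1, h2, h3,
      ip_comm (vecMulVec (-u) o), h3]
    norm_num
  have hqN : q N ≤ 2 * β := by
    have h1 := hβ (vecMulVec (-u) p) (vecMulVec o v)
      (rank_vecMulVec_eq_one (by simpa using hu) hpp)
      (norm_vecMulVec_eq_one (by simpa using hu) hpp)
      (rank_vecMulVec_eq_one hoo hv) (norm_vecMulVec_eq_one hoo hv)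
    have h2 : vecMulVec (-u) p * (A * Bᵀ) + A * Bᵀ * vecMulVec o v = s i • N := by
      rw [vecMulVec_mul, ← mulVec_transpose, hXp, mul_vecMulVec, hXo, vecMulVec_smul,
        smul_vecMulVec, hN, smul_add, add_comm]
    rw [h2, h.smul, norm_smul, mul_pow, hNorm, Real.norm_of_nonneg hs.le] at h1
    have h3 : 0 < s i ^ 2 := by positivity
    nlinarith
  -- The coefficient vectors c⁻¹Aᵀp and c⁻¹Bᵀo are sent by B and A to c o and c p. Their mutual
  -- inner product is 1 even for unbalanced factors; their squared lengths matter only after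
  -- multiplication by λ.
  set c := √(s i) with hc
  have hcs : c * c = s i := Real.mul_self_sqrt hs.le
  have hcpos : 0 < c := Real.sqrt_pos.mpr hs
  have hAb : A *ᵥ (c⁻¹ • (Bᵀ *ᵥ o)) = c • p := by
    rw [mulVec_smul, mulVec_mulVec, hXo, smul_smul, ← hcs]
    congr 1
    field_simp
  have hBa : B *ᵥ (c⁻¹ • (Aᵀ *ᵥ p)) = c • o := by
    rw [transpose_mul, transpose_transpose] at hXp
    rw [mulVec_smul, mulVec_mulVec, hXp, smul_smul, ← hcs]
    congr 1
    field_simp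
  have hab : (c⁻¹ • (Aᵀ *ᵥ p)) ⬝ᵥ (c⁻¹ • (Bᵀ *ᵥ o)) = 1 := by
    rw [smul_dotProduct, dotProduct_comm, dotProduct_mulVec, ← mulVec_transpose,
      transpose_transpose, hAb, smul_dotProduct, hpp, smul_eq_mul, smul_eq_mul, mul_one]
    field_simp
  have haa : lam * ((c⁻¹ • (Aᵀ *ᵥ p)) ⬝ᵥ (c⁻¹ • (Aᵀ *ᵥ p))) = lam := by
    have h1 := congrArg (fun x => p ⬝ᵥ x) (h.gram_left hX i)
    simp only [dotProduct_smul, smul_eq_mul] at h1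
    rw [← hp, hpp, ← mulVec_mulVec, dotProduct_mulVec, ← mulVec_transpose] at h1
    simp only [smul_dotProduct, dotProduct_smul, smul_eq_mul]
    calc lam * (c⁻¹ * (c⁻¹ * ((Aᵀ *ᵥ p) ⬝ᵥ (Aᵀ *ᵥ p))))
        = c⁻¹ * c⁻¹ * (lam * ((Aᵀ *ᵥ p) ⬝ᵥ (Aᵀ *ᵥ p))) := by ring
      _ = lam := by
        rw [h1, ← hcs]
        field_simp
  have hbb : lam * ((c⁻¹ • (Bᵀ *ᵥ o)) ⬝ᵥ (c⁻¹ • (Bᵀ *ᵥ o))) = lam := by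
    have h1 := congrArg (fun x => o ⬝ᵥ x) (h.gram_right hX i)
    simp only [dotProduct_smul, smul_eq_mul] at h1
    rw [← ho, hoo, ← mulVec_mulVec, dotProduct_mulVec, ← mulVec_transpose] at h1
    simp only [smul_dotProduct, dotProduct_smul, smul_eq_mul]
    calc lam * (c⁻¹ * (c⁻¹ * ((Bᵀ *ᵥ o) ⬝ᵥ (Bᵀ *ᵥ o))))
        = c⁻¹ * c⁻¹ * (lam * ((Bᵀ *ᵥ o) ⬝ᵥ (Bᵀ *ᵥ o))) := by ring
      _ = lam := by
        rw [h1, ← hcs]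
        field_simp
  have key := h.rank_one (-u) v (c⁻¹ • (Aᵀ *ᵥ p)) (c⁻¹ • (Bᵀ *ᵥ o))
  rw [hAb, hBa, hab, smul_vecMulVec, vecMulVec_smul, ← smul_add, ← hN, h.smul, sq, hcs,
    neg_dotProduct, neg_dotProduct, dotProduct_neg, neg_neg, hu, hv, one_mul, one_mul, mul_add,
    haa, hbb] at key
  nlinarith

/-- Normalize u and v, then pass from the product of lengths to the sum of squares by AM-GM. -/
theorem two_mul_dotProduct_le_of_unit {t : ℝ} {u : Fin m → ℝ} {v : Fin n → ℝ}
    {G : Matrix (Fin m) (Fin n) ℝ} (ht : 0 ≤ t)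
    (h : ∀ a b : ℝ, (a • u) ⬝ᵥ (a • u) = 1 → (b • v) ⬝ᵥ (b • v) = 1 →
      (a • u) ⬝ᵥ (G *ᵥ (b • v)) ≤ t) :
    2 * (u ⬝ᵥ (G *ᵥ v)) ≤ t * (u ⬝ᵥ u + v ⬝ᵥ v) := by
  have hu0 := dotProduct_self_nonneg' u
  have hv0 := dotProduct_self_nonneg' v
  rcases eq_or_ne u 0 with rfl | hu
  · simpa using mul_nonneg ht hv0
  rcases eq_or_ne v 0 with rfl | hv
  · simpa using mul_nonneg ht hu0
  have hu1 := dotProduct_self_pos hu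
  have hv1 := dotProduct_self_pos hv
  set a := √(u ⬝ᵥ u)
  set b := √(v ⬝ᵥ v)
  have ha : a * a = u ⬝ᵥ u := Real.mul_self_sqrt hu0
  have hb : b * b = v ⬝ᵥ v := Real.mul_self_sqrt hv0
  have hap : 0 < a := Real.sqrt_pos.mpr hu1
  have hbp : 0 < b := Real.sqrt_pos.mpr hv1
  have h1 := h a⁻¹ b⁻¹
    (by simp only [smul_dotProduct, dotProduct_smul, smul_eq_mul, ← ha]; field_simp)
    (by simp only [smul_dotProduct, dotProduct_smul, smul_eq_mul, ← hb]; field_simp)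
  simp only [smul_dotProduct, dotProduct_smul, smul_eq_mul, mulVec_smul] at h1
  have h2 : a * b * (a⁻¹ * (b⁻¹ * (u ⬝ᵥ (G *ᵥ v)))) = u ⬝ᵥ (G *ᵥ v) := by field_simp
  have h3 := mul_le_mul_of_nonneg_left h1 (mul_pos hap hbp).le
  rw [← ha, ← hb]
  nlinarith [mul_nonneg ht (sq_nonneg (a - b))]

end Factor

/-! ### Splitting the gradient into a subgradient and an excess. -/

/-- A gradient aligned with the singular vectors and bounded by `lam + κ` on their orthogonal
complement exceeds the subdifferential of `lam ‖·‖_*` by `κ` times a contraction supported on that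
complement. -/
theorem exists_excess_contraction {lam κ : ℝ} (hlam : 0 ≤ lam) (hκ : 0 ≤ κ)
    {G : Matrix (Fin m) (Fin n) ℝ} {P : Matrix (Fin m) (Fin l) ℝ} {Q : Matrix (Fin n) (Fin l) ℝ}
    (hP : Pᵀ * P = 1) (hQ : Qᵀ * Q = 1) (hGQ : G * Q = -(lam • P)) (hGP : Gᵀ * P = -(lam • Q))
    (hG : ∀ u v, Pᵀ *ᵥ u = 0 → Qᵀ *ᵥ v = 0 →
      2 * (u ⬝ᵥ (G *ᵥ v)) ≤ (lam + κ) * (u ⬝ᵥ u + v ⬝ᵥ v)) :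
    ∃ W : Matrix (Fin m) (Fin n) ℝ, OpNormLE 1 W ∧ W * Q = 0 ∧ Wᵀ * P = 0 ∧
      ∀ Y, -ip G Y ≤ lam * nuclearNorm Y + κ * ip W Y := by
  -- N is the block of G on the complement of the singular spaces; its operator norm is at most λ +
  -- κ.
  set N := G + lam • (P * Qᵀ) with hN
  have hNQ : N * Q = 0 := by
    rw [hN, Matrix.add_mul, hGQ, Matrix.smul_mul, Matrix.mul_assoc, hQ, Matrix.mul_one]
    simp
  have hNP : Nᵀ * P = 0 := by
    rw [hN, transpose_add, transpose_smul, transpose_mul, transpose_transpose, Matrix.add_mul,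
      hGP, Matrix.smul_mul, Matrix.mul_assoc, hP, Matrix.mul_one]
    simp
  have hbound : ∀ u v, 2 * (u ⬝ᵥ (N *ᵥ v)) ≤ (lam + κ) *
      ((u ⬝ᵥ u - (Pᵀ *ᵥ u) ⬝ᵥ (Pᵀ *ᵥ u)) + (v ⬝ᵥ v - (Qᵀ *ᵥ v) ⬝ᵥ (Qᵀ *ᵥ v))) := by
    intro u v
    have h1 := hG (u - P *ᵥ (Pᵀ *ᵥ u)) (v - Q *ᵥ (Qᵀ *ᵥ v))
      (by rw [mulVec_sub, mulVec_mulVec, hP, one_mulVec, sub_self])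
      (by rw [mulVec_sub, mulVec_mulVec, hQ, one_mulVec, sub_self])
    rw [dotProduct_self_sub_proj hP, dotProduct_self_sub_proj hQ] at h1
    have h2 : G *ᵥ (v - Q *ᵥ (Qᵀ *ᵥ v)) = N *ᵥ v := by
      rw [mulVec_sub, mulVec_mulVec, hGQ, hN, add_mulVec, smul_mulVec, neg_mulVec, smul_mulVec,
        mulVec_mulVec, sub_neg_eq_add]
    have h3 : (P *ᵥ (Pᵀ *ᵥ u)) ⬝ᵥ (N *ᵥ v) = 0 := by
      rw [dotProduct_mulVec, ← mulVec_transpose, mulVec_mulVec, hNP, zero_mulVec, zero_dotProduct]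
    rw [h2, sub_dotProduct, h3, sub_zero] at h1
    exact h1
  have hNop : OpNormLE (lam + κ) N := fun u v => by
    refine (hbound u v).trans (mul_le_mul_of_nonneg_left ?_ (by linarith))
    linarith [dotProduct_self_nonneg' (Pᵀ *ᵥ u), dotProduct_self_nonneg' (Qᵀ *ᵥ v)]
  rcases (add_nonneg hlam hκ).eq_or_lt with h0 | hpos
  · have hl : lam = 0 := by linarith
    have hk : κ = 0 := by linarith
    subst hl hk
    refine ⟨0, fun u v => ?_, by simp, by simp, fun Y => ?_⟩
    · simpa using add_nonneg (dotProduct_self_nonneg' u) (dotProduct_self_nonneg' v)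
    · have := hNop.neg.ip_le_nuclearNorm Y
      rw [hN, ip_neg_left] at this
      simpa using this
  · set c := (lam + κ)⁻¹ with hc
    have hcpos : 0 < c := inv_pos.mpr hpos
    have hc1 : c * (lam + κ) = 1 := inv_mul_cancel₀ hpos.ne'
    -- Normalizing -N gives W. The remainder -G - κW is λ(PQᵀ + W), a sum of blocks with orthogonal
    -- supports, hence of operator norm at most λ.
    refine ⟨-(c • N), ?_, by simp [hNQ], by simp [hNP], fun Y => ?_⟩
    · have := (hNop.smul hcpos.le).neg
      rwa [hc1] at this
    · have hop : OpNormLE lam (-(G + κ • -(c • N))) := by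
        have he : -(G + κ • -(c • N)) = lam • (P * Qᵀ) - (lam * c) • N := by
          have h1 : (lam * c) • N + (κ * c) • N = N := by
            rw [← add_smul, show lam * c + κ * c = 1 by linarith, one_smul]
          have h2 : G = N - lam • (P * Qᵀ) := by rw [hN]; abel
          rw [smul_neg, smul_smul]
          nth_rewrite 1 [h2]
          nth_rewrite 1 [← h1]
          abel
        rw [he]
        intro u v
        rw [sub_mulVec, dotProduct_sub, smul_mulVec, smul_mulVec, dotProduct_smul, dotProduct_smul,
          ← mulVec_mulVec, dotProduct_mulVec, ← mulVec_transpose, smul_eq_mul, smul_eq_mul]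
        have h1 := mul_le_mul_of_nonneg_left (two_mul_dotProduct_le (Pᵀ *ᵥ u) (Qᵀ *ᵥ v)) hlam
        have h2 := hbound (-u) v
        simp only [neg_dotProduct, dotProduct_neg, mulVec_neg, neg_neg] at h2
        have h3 := mul_le_mul_of_nonneg_left h2 (mul_nonneg hlam hcpos.le)
        have h4 : lam * c * ((lam + κ) * ((u ⬝ᵥ u - (Pᵀ *ᵥ u) ⬝ᵥ (Pᵀ *ᵥ u)) +
            (v ⬝ᵥ v - (Qᵀ *ᵥ v) ⬝ᵥ (Qᵀ *ᵥ v)))) = lam * ((u ⬝ᵥ u - (Pᵀ *ᵥ u) ⬝ᵥ (Pᵀ *ᵥ u)) +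
            (v ⬝ᵥ v - (Qᵀ *ᵥ v) ⬝ᵥ (Qᵀ *ᵥ v))) := by
          rw [mul_assoc, ← mul_assoc c, hc1, one_mul]
        rw [h4] at h3
        linarith
      have := hop.ip_le_nuclearNorm Y
      rw [ip_neg_left, ip_add_left, ip_smul_left] at this
      linarith

/-! ### Distance and pairing bounds for low-rank matrices. -/

section LowRank

variable {X : Matrix (Fin m) (Fin n) ℝ} {P : Matrix (Fin m) (Fin r) ℝ} {s : Fin r → ℝ}
  {Q : Matrix (Fin n) (Fin r) ℝ} {W : Matrix (Fin m) (Fin n) ℝ}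

theorem norm_sq_mul_diagonal_mul (hP : Pᵀ * P = 1) (hQ : Qᵀ * Q = 1) (d : Fin r → ℝ) :
    ‖P * diagonal d * Qᵀ‖ ^ 2 = ∑ i, d i ^ 2 := by
  rw [norm_sq_eq_ip, ip_mul_right, transpose_transpose, Matrix.mul_assoc, hQ, Matrix.mul_one,
    ip_mul_left, ← Matrix.mul_assoc, hP, Matrix.one_mul, ip, diagonal_transpose,
    diagonal_mul_diagonal, trace_diagonal]
  simp [sq]

theorem IsSVD.norm_sq (h : IsSVD X P s Q) : ‖X‖ ^ 2 = ∑ i, s i ^ 2 := by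
  rw [h.eq, norm_sq_mul_diagonal_mul h.left h.right]

theorem IsSVD.le_norm (h : IsSVD X P s Q) (i : Fin r) : s i ≤ ‖X‖ := by
  refine le_of_sq_le_sq ?_ (norm_nonneg _)
  rw [h.norm_sq]
  exact Finset.single_le_sum (f := fun i => s i ^ 2) (fun i _ => sq_nonneg _) (Finset.mem_univ i)

theorem IsSVD.antitone (h : IsSVD X P s Q) : Antitone s := fun i j hij => by
  rw [h.eq_sigma, h.eq_sigma]
  exact sigma_antitone X (by simpa using hij)

theorem IsSVD.mul_right_mul_transpose (h : IsSVD X P s Q) : X * Q * Qᵀ = X := by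
  nth_rewrite 1 [h.eq]
  rw [Matrix.mul_assoc _ Qᵀ Q, h.right, Matrix.mul_one, ← h.eq]

/-- The squared Frobenius norm of the best approximation of rank `k`. -/
def headSq (s : Fin r → ℝ) (k : ℕ) : ℝ := ∑ i : Fin r, if (i : ℕ) < k then s i ^ 2 else 0

theorem IsSVD.norm_sq_sub_le_of_isRankProjection (h : IsSVD X P s Q)
    {Y : Matrix (Fin m) (Fin n) ℝ} (hY : IsRankProjection k X Y) :
    ‖X - Y‖ ^ 2 ≤ ‖X‖ ^ 2 - headSq s k := by
  -- The truncated decomposition is the competitor; the full Eckart–Young theorem is not needed.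
  set d : Fin r → ℝ := fun i => if (i : ℕ) < k then s i else 0 with hd
  have hrank : (P * diagonal d * Qᵀ).rank ≤ k := by
    classical
    refine ((rank_mul_le_left _ _).trans (rank_mul_le_right _ _)).trans ?_
    rw [Matrix.rank_diagonal]
    have hinj : Function.Injective fun i : {i // d i ≠ 0} =>
        (⟨i.1, by
          by_contra hk
          exact i.2 (if_neg hk)⟩ : Fin k) := by
      intro i j hij
      simpa [Subtype.ext_iff, Fin.ext_iff] using hij
    simpa using Fintype.card_le_of_injective _ hinj
  have h1 := pow_le_pow_left₀ (norm_nonneg _) (hY.2 _ hrank) 2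
  have h2 : X - P * diagonal d * Qᵀ = P * diagonal (fun i => s i - d i) * Qᵀ := by
    rw [← diagonal_sub, Matrix.mul_sub, Matrix.sub_mul, ← h.eq]
  rw [h2, norm_sq_mul_diagonal_mul h.left h.right] at h1
  refine h1.trans (le_of_eq ?_)
  rw [h.norm_sq, headSq, ← Finset.sum_sub_distrib]
  refine Finset.sum_congr rfl fun i _ => ?_
  simp only [hd]
  split_ifs <;> ring

/-- A variational bound of Ky Fan type for `X + τ W`, where `W` is a contraction supported on the
complement of the singular spaces of `X` and `τ` is the `k`-th singular value. -/
theorem IsSVD.norm_sq_mul_le (h : IsSVD X P s Q) (hW : OpNormLE 1 W) (hWQ : W * Q = 0)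
    (hWP : Wᵀ * P = 0) (i₀ : Fin r) (hk : (i₀ : ℕ) + 1 = k) {O : Matrix (Fin n) (Fin k) ℝ}
    (hO : Oᵀ * O = 1) : ‖(X + s i₀ • W) * O‖ ^ 2 ≤ headSq s k := by
  set τ := s i₀ with hτ
  have hτ0 : 0 < τ := h.pos i₀
  have hXW : Xᵀ * W = 0 := by
    have hPW : Pᵀ * W = 0 := by
      have := congrArg transpose hWP
      simpa [transpose_mul] using this
    rw [h.transpose_eq, Matrix.mul_assoc, hPW, Matrix.mul_zero]
  -- The ranges of X and W are orthogonal, and W sees only the component of o outside the right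
  -- singular space.
  have hcol : ∀ o : Fin n → ℝ, o ⬝ᵥ o = 1 →
      ((X + τ • W) *ᵥ o) ⬝ᵥ ((X + τ • W) *ᵥ o) ≤
        τ ^ 2 + ∑ i, (s i ^ 2 - τ ^ 2) * (Qᵀ *ᵥ o) i ^ 2 := by
    intro o ho
    have h1 : (X *ᵥ o) ⬝ᵥ (W *ᵥ o) = 0 := by
      rw [dotProduct_comm, dotProduct_mulVec, ← mulVec_transpose, mulVec_mulVec, hXW, zero_mulVec,
        zero_dotProduct]
    have h2 : (X *ᵥ o) ⬝ᵥ (X *ᵥ o) = ∑ i, s i ^ 2 * (Qᵀ *ᵥ o) i ^ 2 := by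
      have : X *ᵥ o = P *ᵥ (diagonal s *ᵥ (Qᵀ *ᵥ o)) := by
        rw [mulVec_mulVec, mulVec_mulVec, ← h.eq]
      rw [this, dotProduct_self_orthonormal_mulVec h.left, dotProduct]
      refine Finset.sum_congr rfl fun i _ => ?_
      rw [mulVec_diagonal]
      ring
    have h3 : (W *ᵥ o) ⬝ᵥ (W *ᵥ o) ≤ 1 - ∑ i, (Qᵀ *ᵥ o) i ^ 2 := by
      have h4 : W *ᵥ o = W *ᵥ (o - Q *ᵥ (Qᵀ *ᵥ o)) := by
        rw [mulVec_sub, mulVec_mulVec _ W, hWQ, zero_mulVec, sub_zero]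
      rw [h4]
      refine (hW.mulVec_le _).trans (le_of_eq ?_)
      rw [dotProduct_self_sub_proj h.right, ho, dotProduct]
      simp only [sq]
    rw [add_mulVec, smul_mulVec, add_dotProduct, dotProduct_add, dotProduct_add, smul_dotProduct,
      smul_dotProduct, dotProduct_smul, dotProduct_smul, dotProduct_comm (W *ᵥ o), h1, h2]
    simp only [smul_eq_mul, mul_zero, add_zero, zero_add, sub_mul, Finset.sum_sub_distrib,
      ← Finset.mul_sum]
    nlinarith [mul_le_mul_of_nonneg_left h3 (sq_nonneg τ)]
  have hk' : ∑ i : Fin r, (if (i : ℕ) < k then τ ^ 2 else 0) = k * τ ^ 2 := by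
    rw [← Finset.sum_filter, Finset.sum_const, nsmul_eq_mul]
    congr 2
    rw [Fin.card_filter_val_lt]
    exact min_eq_right (by omega)
  have ht : ∀ i, ∑ j, (Qᵀ *ᵥ Oᵀ j) i ^ 2 ≤ 1 := by
    intro i
    have h1 := bessel hO (Qᵀ i)
    rw [col_dotProduct_self h.right] at h1
    refine le_trans (le_of_eq ?_) h1
    rw [dotProduct]
    refine Finset.sum_congr rfl fun j _ => ?_
    rw [sq, mulVec, mulVec, dotProduct_comm]
  calc ‖(X + τ • W) * O‖ ^ 2
      = ∑ j, ((X + τ • W) *ᵥ Oᵀ j) ⬝ᵥ ((X + τ • W) *ᵥ Oᵀ j) := by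
        rw [norm_sq_eq_sum_col]
        simp only [transpose_mul_apply]
    _ ≤ ∑ j : Fin k, (τ ^ 2 + ∑ i, (s i ^ 2 - τ ^ 2) * (Qᵀ *ᵥ Oᵀ j) i ^ 2) :=
        Finset.sum_le_sum fun j _ => hcol _ (col_dotProduct_self hO j)
    _ = k * τ ^ 2 + ∑ i, (s i ^ 2 - τ ^ 2) * ∑ j, (Qᵀ *ᵥ Oᵀ j) i ^ 2 := by
        rw [Finset.sum_add_distrib, Finset.sum_comm]
        simp [Finset.mul_sum]
    _ ≤ k * τ ^ 2 + ∑ i : Fin r, (if (i : ℕ) < k then s i ^ 2 - τ ^ 2 else 0) := by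
        refine add_le_add_right (Finset.sum_le_sum fun i _ => ?_) _
        -- Each weight lies in [0, 1] by Bessel. Since τ is the k-th singular value, its coefficient
        -- is nonnegative for the first k indices and nonpositive afterwards, so the extreme weights
        -- are 1 and 0.
        have hnn : 0 ≤ ∑ j, (Qᵀ *ᵥ Oᵀ j) i ^ 2 := Finset.sum_nonneg fun _ _ => sq_nonneg _
        split_ifs with hi
        · have : τ ≤ s i := h.antitone (Fin.le_def.mpr (by omega))
          have : 0 ≤ s i ^ 2 - τ ^ 2 := by nlinarith
          nlinarith [ht i]
        · have : s i ≤ τ := h.antitone (Fin.le_def.mpr (by omega))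
          have : s i ^ 2 - τ ^ 2 ≤ 0 := by nlinarith [h.pos i]
          exact mul_nonpos_of_nonpos_of_nonneg this hnn
    _ = headSq s k := by
        rw [headSq, ← hk', ← Finset.sum_add_distrib]
        refine Finset.sum_congr rfl fun i _ => ?_
        split_ifs <;> ring

/-- Compressing to the row space of Y preserves both the pairing and ‖Y‖, so only the restriction of
Z to a k-dimensional space matters. -/
theorem two_mul_ip_le_of_forall {Z Y : Matrix (Fin m) (Fin n) ℝ} {b : ℝ} (hY : Y.rank = k)
    (hZ : ∀ O : Matrix (Fin n) (Fin k) ℝ, Oᵀ * O = 1 → ‖Z * O‖ ^ 2 ≤ b) :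
    2 * ip Z Y ≤ b + ‖Y‖ ^ 2 := by
  obtain ⟨P', s', O, h⟩ := exists_isSVD Y hY
  have h1 : ip Z Y = ip (Z * O) (Y * O) := by
    rw [ip_mul_right, h.mul_right_mul_transpose]
  have h2 : ‖Y * O‖ ^ 2 = ‖Y‖ ^ 2 := by
    rw [norm_sq_eq_ip, ip_mul_right, h.mul_right_mul_transpose, norm_sq_eq_ip]
  have h3 := ip_le_half (Z * O) (Y * O)
  rw [h1]
  linarith [hZ O h.right]

/-- The lower bound for the distance from `X` to a matrix near the rank-`k` matrix `Y`. -/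
theorem IsSVD.two_mul_ip_le (h : IsSVD X P s Q) (hW : OpNormLE 1 W) (hWQ : W * Q = 0)
    (hWP : Wᵀ * P = 0) (i₀ : Fin r) (hk : (i₀ : ℕ) + 1 = k) {Xs Y : Matrix (Fin m) (Fin n) ℝ}
    (hY : Y.rank = k) {δ L : ℝ} (hδ : ‖Y - Xs‖ ≤ δ) (hδL : δ ≤ L) (hXL : ‖X‖ ≤ L)
    (hXsL : ‖Xs‖ ≤ L) :
    2 * (s i₀ * ip W Xs) + (‖X‖ ^ 2 - headSq s k) ≤ ‖X - Xs‖ ^ 2 + L * (2 * n + 7) * δ := by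
  have h1 := two_mul_ip_le_of_forall (Z := X + s i₀ • W) hY
    fun O hO => h.norm_sq_mul_le hW hWQ hWP i₀ hk hO
  have hδ0 : 0 ≤ δ := (norm_nonneg _).trans hδ
  have hL0 : 0 ≤ L := (norm_nonneg _).trans hXL
  have hWn := hW.norm_le
  have hZ : ‖X + s i₀ • W‖ ≤ L * (n + 2) := by
    refine (norm_add_le _ _).trans ?_
    rw [norm_smul, Real.norm_of_nonneg (h.pos i₀).le]
    have := mul_le_mul ((h.le_norm i₀).trans hXL) hWn (norm_nonneg _) hL0
    linarith
  have h2 : ip (X + s i₀ • W) (Xs - Y) ≤ L * (n + 2) * δ := by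
    refine (ip_le_norm_mul_norm _ _).trans ?_
    rw [norm_sub_rev]
    exact mul_le_mul hZ hδ (norm_nonneg _) (by positivity)
  have h3 : ‖Y‖ ^ 2 ≤ ‖Xs‖ ^ 2 + 3 * L * δ := by
    have h4 : ‖Y‖ ≤ ‖Xs‖ + δ := by
      have := norm_add_le Xs (Y - Xs)
      rw [add_sub_cancel] at this
      linarith
    nlinarith [pow_le_pow_left₀ (norm_nonneg _) h4 2, norm_nonneg Xs]
  have h5 : ip (X + s i₀ • W) Y + ip (X + s i₀ • W) (Xs - Y) = ip X Xs + s i₀ * ip W Xs := by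
    rw [← ip_add_right, add_sub_cancel, ip_add_left, ip_smul_left]
  rw [norm_sq_sub]
  linarith

/-- On the row space of M the contraction has Frobenius norm at most √(rank M); conclude by
Cauchy–Schwarz. -/
theorem OpNormLE.ip_le_sqrt_rank (hW : OpNormLE 1 W) {M : Matrix (Fin m) (Fin n) ℝ}
    (hM : M.rank ≤ k) : ip W M ≤ √(k : ℝ) * ‖M‖ := by
  obtain ⟨l, hl⟩ : ∃ l, M.rank = l := ⟨_, rfl⟩
  obtain ⟨P', s', O, h⟩ := exists_isSVD M hl
  have h1 : ip W M = ip (W * O) (M * O) := by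
    rw [ip_mul_right, h.mul_right_mul_transpose]
  have h2 : ‖M * O‖ ≤ ‖M‖ := by
    refine le_of_sq_le_sq (le_of_eq ?_) (norm_nonneg _)
    rw [norm_sq_eq_ip, ip_mul_right, h.mul_right_mul_transpose, norm_sq_eq_ip]
  have h3 : ‖W * O‖ ≤ √(k : ℝ) := by
    refine (hW.norm_mul_le O).trans (Real.le_sqrt_of_sq_le ?_)
    rw [norm_sq_orthonormal h.right]
    exact_mod_cast hl ▸ hM
  rw [h1]
  exact (ip_le_norm_mul_norm _ _).trans
    (mul_le_mul h3 h2 (norm_nonneg _) (Real.sqrt_nonneg _))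

theorem norm_sub_mul_proj_le (hQ : Qᵀ * Q = 1) (E : Matrix (Fin m) (Fin n) ℝ) :
    ‖E - E * Q * Qᵀ‖ ≤ ‖E‖ := by
  refine le_of_sq_le_sq ?_ (norm_nonneg _)
  have h1 : ip E (E * Q * Qᵀ) = ‖E * Q‖ ^ 2 := by
    rw [← ip_mul_right, norm_sq_eq_ip]
  have h2 : ‖E * Q * Qᵀ‖ ^ 2 = ‖E * Q‖ ^ 2 := by
    rw [norm_sq_eq_ip, ip_mul_right, transpose_transpose, Matrix.mul_assoc (E * Q), hQ,
      Matrix.mul_one, norm_sq_eq_ip]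
  rw [norm_sq_sub, h1, h2]
  nlinarith [sq_nonneg ‖E * Q‖]

/-- As WQ = 0, Y may be replaced by Y(1 - QQᵀ) = (Y - X)(1 - QQᵀ). The first form keeps the rank at
most k, the second is bounded by the distance to X. -/
theorem IsSVD.ip_le_sqrt_mul (h : IsSVD X P s Q) (hW : OpNormLE 1 W) (hWQ : W * Q = 0)
    {Y : Matrix (Fin m) (Fin n) ℝ} (hY : Y.rank = k) : ip W Y ≤ √(k : ℝ) * ‖Y - X‖ := by
  have h1 : Y - Y * Q * Qᵀ = (Y - X) - (Y - X) * Q * Qᵀ := by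
    rw [Matrix.sub_mul, Matrix.sub_mul, h.mul_right_mul_transpose]
    abel
  have h2 : ip W (Y - Y * Q * Qᵀ) = ip W Y := by
    rw [ip_sub_right, ← ip_mul_right, hWQ]
    simp [ip]
  have h3 : (Y - Y * Q * Qᵀ).rank ≤ k := by
    have : Y - Y * Q * Qᵀ = Y * (1 - Q * Qᵀ) := by
      rw [Matrix.mul_sub, Matrix.mul_one, Matrix.mul_assoc]
    rw [this, ← hY]
    exact rank_mul_le_left _ _
  rw [← h2]
  refine (hW.ip_le_sqrt_rank h3).trans (mul_le_mul_of_nonneg_left ?_ (Real.sqrt_nonneg _))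
  rw [h1]
  exact norm_sub_mul_proj_le h.right _

end LowRank

/-! ### Stationary points away from the minimizer. -/

section Landscape

variable {f : Matrix (Fin m) (Fin n) ℝ → ℝ} {lam α β D : ℝ} {Xs : Matrix (Fin m) (Fin n) ℝ}
  {A : Matrix (Fin m) (Fin r) ℝ} {B : Matrix (Fin n) (Fin r) ℝ}

theorem rank_mul_transpose_le : (A * Bᵀ).rank ≤ r := by
  refine (rank_mul_le_left A Bᵀ).trans ?_
  simpa using A.rank_le_width

/-- Restricted strong convexity compares the gradient at the stationary point with the
subdifferential of the regularizer. -/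
theorem mul_norm_sq_le_neg_ip (hf : TwiceDifferentiable f) (hlam : 0 ≤ lam)
    (hmin : IsGlobalMinimizer (fullLoss f lam) Xs) (hα : RestrictedStronglyConvex f Xs α r D)
    (hD : ‖A * Bᵀ - Xs‖ ≤ D) {G : Matrix (Fin m) (Fin n) ℝ}
    (hG : ∀ H, fderiv ℝ f (A * Bᵀ) H = ip G H)
    (h : FactorSOSP lam G (hessQuad f (A * Bᵀ)) A B) :
    α * ‖A * Bᵀ - Xs‖ ^ 2 ≤ -ip G Xs - lam * nuclearNorm Xs := by
  have h1 : α * ‖A * Bᵀ - Xs‖ ^ 2 ≤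
      fderiv ℝ f (A * Bᵀ) (A * Bᵀ - Xs) - fderiv ℝ f Xs (A * Bᵀ - Xs) :=
    hα (A * Bᵀ) hD rank_mul_transpose_le
  have h2 := hmin.neg_fderiv_le hf.1 hlam (A * Bᵀ)
  rw [hG, ip_sub_right] at h1
  linarith [h.ip_le hlam]

theorem rank_eq_and_exists_contraction (hf : TwiceDifferentiable f) (hlam : 0 ≤ lam)
    (hα0 : 0 < α) (hmin : IsGlobalMinimizer (fullLoss f lam) Xs)
    (hα : RestrictedStronglyConvex f Xs α r D) (hβ : RestrictedSmooth f Xs β r D)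
    (hS : IsSOSP (loraLoss r f lam) (A, B)) (hD : ‖A * Bᵀ - Xs‖ ≤ D)
    (hne : 0 < ‖A * Bᵀ - Xs‖) :
    (A * Bᵀ).rank = r ∧ ∀ i : Fin r, ∃ (P : Matrix (Fin m) (Fin r) ℝ) (s : Fin r → ℝ)
      (Q : Matrix (Fin n) (Fin r) ℝ) (W : Matrix (Fin m) (Fin n) ℝ), IsSVD (A * Bᵀ) P s Q ∧
        OpNormLE 1 W ∧ W * Q = 0 ∧ Wᵀ * P = 0 ∧ 0 < β ∧ 0 < ip W Xs ∧
        α * ‖A * Bᵀ - Xs‖ ^ 2 ≤ β * s i * ip W Xs := by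
  obtain ⟨G, hG⟩ := exists_ip_representation (fderiv ℝ f (A * Bᵀ))
  have h := hS.factorSOSP hf hG
  have hgap := mul_norm_sq_le_neg_ip hf hlam hmin hα hD hG h
  have hpos : 0 < α * ‖A * Bᵀ - Xs‖ ^ 2 := by positivity
  have hrank : (A * Bᵀ).rank = r := by
    refine le_antisymm rank_mul_transpose_le ?_
    by_contra! hlt
    have h1 := (h.opNormLE_of_rank_lt hlt).neg.ip_le_nuclearNorm Xs
    rw [ip_neg_left] at h1
    linarith
  refine ⟨hrank, fun i => ?_⟩
  obtain ⟨P, s, Q, hX⟩ := exists_isSVD (A * Bᵀ) hrank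
  have hs := hX.pos i
  -- The sign of β is not known in advance, while the excess must be nonnegative. Positivity of β
  -- follows afterwards, because a zero excess would contradict αρ² > 0.
  have hle : β * s i ≤ max (β * s i) 0 := le_max_left _ _
  have hκ : 0 ≤ max (β * s i) 0 := le_max_right _ _
  obtain ⟨W, hW, hWQ, hWP, hY⟩ := exists_excess_contraction hlam hκ hX.left hX.right
    (h.mul_right hX) (h.mul_left hX) fun u v hu hv =>
      two_mul_dotProduct_le_of_unit (add_nonneg hlam hκ) fun a b ha hb =>
        (h.dotProduct_le hX (hβ _ hD rank_mul_transpose_le) i ha hb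
          (by rw [mulVec_smul, hu, smul_zero])).trans (by linarith)
  have h1 := hY Xs
  have h2 : 0 < max (β * s i) 0 * ip W Xs := by linarith
  have h3 : 0 < max (β * s i) 0 := lt_of_le_of_ne hκ fun h0 => by
    rw [← h0, zero_mul] at h2
    exact lt_irrefl _ h2
  have h4 : 0 < β * s i := by
    by_contra! h5
    rw [max_eq_right h5] at h3
    exact lt_irrefl _ h3
  rw [max_eq_left h4.le] at h1 h2
  exact ⟨P, s, Q, W, hX, hW, hWQ, hWP, (pos_iff_pos_of_mul_pos h4).mpr hs,
    (pos_iff_pos_of_mul_pos h2).mp h4, by linarith⟩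

end Landscape

/-! ### Combining the bounds. -/

/-- The numerical consequences of the two bounds relating `ρ = ‖X - X⋆‖`, the singular values
`σ = σ_r`, `τ = σ_{r⋆}` of `X`, the pairing `ν`, and the tail `T` of the singular values. -/
theorem numeric_bounds {α β ε ρ σ τ ν T : ℝ} (hβ : 0 < β) (hε : 0 < ε) (hρ : ε < ρ)
    (hσ : 0 < σ) (hστ : σ ≤ τ) (hT : 0 ≤ T) (h1 : α * ρ ^ 2 ≤ β * σ * ν)
    (h2 : 2 * (τ * ν) + T ≤ ρ ^ 2 + ε ^ 3) :
    2 * α < β * (1 + ε) ∧ 2 * α / (β * (1 + ε)) * τ ≤ σ ∧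
      (2 * α / β * τ < σ → ∀ t, t ≤ T →
        √((t - ε ^ 3) / (1 - 2 * α * τ / (β * σ))) - ε ^ 2 ≤ ρ) := by
  have hρ0 : 0 < ρ := hε.trans hρ
  have hτ : 0 < τ := hσ.trans_le hστ
  have hεsq : ε ^ 2 < ρ ^ 2 := pow_lt_pow_left₀ hρ hε.le two_ne_zero
  have hcube : ε ^ 3 < ε * ρ ^ 2 := by nlinarith
  -- Multiplying the first bound by 2τ makes it composable with the second, which eliminates ν.
  have h3 : 2 * α * τ * ρ ^ 2 ≤ β * σ * (2 * (τ * ν)) := by nlinarith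
  have h4 : β * σ * (2 * (τ * ν)) ≤ β * σ * (ρ ^ 2 + ε ^ 3 - T) :=
    mul_le_mul_of_nonneg_left (by linarith) (by positivity)
  have hβσ : 0 < β * σ := by positivity
  have h5 : 2 * α * τ * ρ ^ 2 < (β * (1 + ε) * σ) * ρ ^ 2 := by
    have : β * σ * (ρ ^ 2 + ε ^ 3 - T) < β * σ * (ρ ^ 2 + ε * ρ ^ 2) :=
      mul_lt_mul_of_pos_left (by linarith) hβσ
    linarith
  have h6 : 2 * α * τ < β * (1 + ε) * σ := lt_of_mul_lt_mul_right h5 (sq_nonneg ρ)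
  refine ⟨?_, ?_, fun hlt t ht => ?_⟩
  · have h7 : β * (1 + ε) * σ ≤ β * (1 + ε) * τ := mul_le_mul_of_nonneg_left hστ (by positivity)
    exact lt_of_mul_lt_mul_right (h6.trans_le h7) hτ.le
  · rw [div_mul_eq_mul_div, div_le_iff₀ (by positivity)]
    linarith
  · have hγ : 0 < 1 - 2 * α * τ / (β * σ) := by
      rw [sub_pos, div_lt_one hβσ]
      rw [div_mul_eq_mul_div, div_lt_iff₀ hβ] at hlt
      linarith
    have h7 : 2 * α * τ / (β * σ) * ρ ^ 2 ≤ ρ ^ 2 + ε ^ 3 - T := by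
      rw [div_mul_eq_mul_div, div_le_iff₀ hβσ]
      linarith
    -- The bound holds even before ε² is subtracted.
    have h8 : √((t - ε ^ 3) / (1 - 2 * α * τ / (β * σ))) ≤ ρ := by
      refine Real.sqrt_le_iff.mpr ⟨hρ0.le, ?_⟩
      rw [div_le_iff₀ hγ]
      linarith
    nlinarith [sq_nonneg ε]

variable {rs : ℕ} {f : Matrix (Fin m) (Fin n) ℝ → ℝ} {lam α β D ε δ L : ℝ}
  {Xs Xδ : Matrix (Fin m) (Fin n) ℝ} {A : Matrix (Fin m) (Fin r) ℝ} {B : Matrix (Fin n) (Fin r) ℝ}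

/-- All the conclusions at a stationary point at distance more than `ε` from the minimizer. -/
theorem sosp_bounds_of_far (hr : rs ≤ r) (hf : TwiceDifferentiable f) (hlam : 0 ≤ lam)
    (hα0 : 0 < α) (hmin : IsGlobalMinimizer (fullLoss f lam) Xs)
    (hα : RestrictedStronglyConvex f Xs α r D) (hβ : RestrictedSmooth f Xs β r D)
    (hS : IsSOSP (loraLoss r f lam) (A, B)) (hD : ‖A * Bᵀ - Xs‖ ≤ D)
    (hε : 0 < ε) (hfar : ε < ‖A * Bᵀ - Xs‖) (hL : 1 ≤ L) (hDL : D ≤ L)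
    (hXL : ‖A * Bᵀ‖ ≤ L) (hXsL : ‖Xs‖ ≤ L) (hXδ : Xδ.rank = rs) (hδ : ‖Xδ - Xs‖ ≤ δ)
    (hδ₁ : 20 * L ^ 3 * (n + 1) * δ ≤ ε ^ 3)
    (hδ₂ : (|β| + 1) * L ^ 2 * (n + 1) * δ < α * ε ^ 3) :
    2 * α < β * (1 + ε) ∧ 1 ≤ rs ∧ (A * Bᵀ).rank = r ∧
      max (2 * α / (β * (1 + ε)) * sigma (A * Bᵀ) rs) (α / (2 * β * √(r : ℝ)) * ε)
        ≤ sigma (A * Bᵀ) r ∧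
      (sigma (A * Bᵀ) r ≤ 2 * α / β * sigma (A * Bᵀ) rs ∨
        ∀ P : Matrix (Fin m) (Fin n) ℝ, IsRankProjection rs (A * Bᵀ) P →
          √((‖A * Bᵀ - P‖ ^ 2 - ε ^ 3) /
            (1 - 2 * α * sigma (A * Bᵀ) rs / (β * sigma (A * Bᵀ) r))) - ε ^ 2
            ≤ ‖A * Bᵀ - Xs‖) := by
  have hδ0 : 0 ≤ δ := (norm_nonneg _).trans hδ
  have hn0 : (0 : ℝ) ≤ n := by positivity
  have hρ0 : 0 < ‖A * Bᵀ - Xs‖ := hε.trans hfar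
  have hεL : ε ≤ L := (hfar.le.trans hD).trans hDL
  have hL0 : 0 < L := by linarith
  have hL23 : L ^ 2 ≤ L ^ 3 := pow_le_pow_right₀ hL (by norm_num)
  have hL13 : L ≤ L ^ 3 := by simpa using pow_le_pow_right₀ hL (show 1 ≤ 3 by norm_num)
  have hL13' : 1 ≤ L ^ 3 := one_le_pow₀ hL
  have hnδ : 0 ≤ (n + 1) * δ := by positivity
  have hδε : 20 * ((n + 1) * δ) ≤ ε := by
    have h1 : ε ^ 3 ≤ ε * L ^ 3 := by
      have h2 : ε ^ 2 ≤ L ^ 2 := pow_le_pow_left₀ hε.le hεL 2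
      nlinarith
    have h2 : L ^ 3 * (20 * ((n + 1) * δ)) ≤ L ^ 3 * ε := by linarith
    exact le_of_mul_le_mul_left h2 (by positivity)
  have hδle : δ ≤ (n + 1) * δ := by nlinarith
  obtain ⟨hrank, hex⟩ := rank_eq_and_exists_contraction hf hlam hα0 hmin hα hβ hS hD hρ0
  have hr1 : 0 < r := by
    by_contra! h0
    obtain rfl : r = 0 := by omega
    obtain rfl : rs = 0 := by omega
    rw [eq_zero_of_rank_eq_zero hXδ, zero_sub, norm_neg] at hδ
    rw [eq_zero_of_rank_eq_zero hrank, zero_sub, norm_neg] at hfar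
    linarith
  -- The smallest singular value gives the strongest curvature bound; `s` counts from 0 and `sigma`
  -- from 1.
  obtain ⟨P, s, Q, W, hX, hW, hWQ, hWP, hβ0, hν, hE⟩ := hex ⟨r - 1, by omega⟩
  set X := A * Bᵀ with hXdef
  set ρ := ‖X - Xs‖ with hρ
  have hWn := hW.norm_le
  have hsr : s ⟨r - 1, by omega⟩ = sigma X r := by
    rw [hX.eq_sigma]
    congr 1
    simp only
    omega
  rw [hsr] at hE
  have hσ0 : 0 < sigma X r := hsr ▸ hX.pos _
  have hσL : sigma X r ≤ L := hsr ▸ (hX.le_norm _).trans hXL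
  -- If r⋆ = 0 then ‖X⋆‖ ≤ δ, so ⟨W, X⋆⟩ = O(δ). But αρ² ≤ βσ_r⟨W, X⋆⟩ and Lρ² ≥ ε³, against the
  -- second smallness condition on δ.
  have hrs1 : 1 ≤ rs := by
    by_contra! h0
    obtain rfl : rs = 0 := by omega
    rw [eq_zero_of_rank_eq_zero hXδ, zero_sub, norm_neg] at hδ
    have h1 : ip W Xs ≤ (n + 1) * δ :=
      (ip_le_norm_mul_norm _ _).trans (mul_le_mul hWn hδ (norm_nonneg _) (by positivity))
    have h2 : β * sigma X r * ip W Xs ≤ (|β| + 1) * L * ((n + 1) * δ) := by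
      refine mul_le_mul (mul_le_mul ?_ hσL hσ0.le (by positivity)) h1 hν.le (by positivity)
      linarith [le_abs_self β]
    have h3 : L * (α * ρ ^ 2) ≤ L * ((|β| + 1) * L * ((n + 1) * δ)) :=
      mul_le_mul_of_nonneg_left (hE.trans h2) hL0.le
    have h4 : α * ε ^ 3 ≤ L * (α * ρ ^ 2) := by
      have h5 : ε ^ 2 ≤ ρ ^ 2 := pow_le_pow_left₀ hε.le hfar.le 2
      have h6 : ε * ε ^ 2 ≤ L * ρ ^ 2 := mul_le_mul hεL h5 (sq_nonneg _) hL0.le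
      nlinarith
    linarith
  have hτeq : s ⟨rs - 1, by omega⟩ = sigma X rs := by
    rw [hX.eq_sigma]
    congr 1
    simp only
    omega
  have hστ : sigma X r ≤ sigma X rs := sigma_antitone X hr
  have hdist := hX.two_mul_ip_le hW hWQ hWP ⟨rs - 1, by omega⟩
    (show (rs - 1) + 1 = rs by omega) hXδ hδ (by linarith) hXL hXsL
  rw [hτeq] at hdist
  have hdist' : 2 * (sigma X rs * ip W Xs) + (‖X‖ ^ 2 - headSq s rs) ≤ ρ ^ 2 + ε ^ 3 := by
    have h1 : L * (2 * n + 7) * δ ≤ 20 * L ^ 3 * (n + 1) * δ := by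
      have h2 : L * (2 * n + 7) ≤ L ^ 3 * (20 * (n + 1)) :=
        mul_le_mul hL13 (by linarith) (by positivity) (by positivity)
      have h3 := mul_le_mul_of_nonneg_right h2 hδ0
      linarith
    linarith
  have hT : 0 ≤ ‖X‖ ^ 2 - headSq s rs := by
    rw [hX.norm_sq, headSq, ← Finset.sum_sub_distrib]
    refine Finset.sum_nonneg fun i _ => ?_
    split_ifs
    · simp
    · simpa using sq_nonneg (s i)
  obtain ⟨hc1, hc2, hc3⟩ := numeric_bounds hβ0 hε hfar hσ0 hστ hT hE hdist'
  refine ⟨hc1, hrs1, hrank, max_le hc2 ?_, ?_⟩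
  · have hsq1 : 1 ≤ √(r : ℝ) := Real.one_le_sqrt.mpr (by exact_mod_cast hr1)
    -- The pairing with the rank-r⋆ approximant is at most √r(ρ + δ). All δ-errors fit into the
    -- second ρ because 20(n+1)δ ≤ ε < ρ.
    have hν2 : ip W Xs ≤ √(r : ℝ) * (2 * ρ) := by
      have h1 : ip W Xs = ip W Xδ + ip W (Xs - Xδ) := by rw [← ip_add_right, add_sub_cancel]
      have h2 : ip W (Xs - Xδ) ≤ (n + 1) * δ := by
        refine (ip_le_norm_mul_norm _ _).trans ?_
        rw [norm_sub_rev]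
        exact mul_le_mul hWn hδ (norm_nonneg _) (by positivity)
      have h3 : ‖Xδ - X‖ ≤ δ + ρ := by
        refine (norm_sub_le_norm_sub_add_norm_sub Xδ Xs X).trans ?_
        rw [norm_sub_rev Xs X]
        linarith
      have h4 : ip W Xδ ≤ √(r : ℝ) * (δ + ρ) :=
        (hX.ip_le_sqrt_mul hW hWQ hXδ).trans
          (mul_le_mul (Real.sqrt_le_sqrt (by exact_mod_cast hr)) h3 (norm_nonneg _)
            (Real.sqrt_nonneg _))
      have h5 : (n + 1) * δ ≤ √(r : ℝ) * ((n + 1) * δ) := le_mul_of_one_le_left hnδ hsq1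
      have h6 : √(r : ℝ) * ((δ + ρ) + (n + 1) * δ) ≤ √(r : ℝ) * (2 * ρ) :=
        mul_le_mul_of_nonneg_left (by linarith) (Real.sqrt_nonneg _)
      linarith
    have h1 : α * ρ * ρ ≤ (sigma X r * (2 * β * √(r : ℝ))) * ρ := by
      have h2 : β * sigma X r * ip W Xs ≤ β * sigma X r * (√(r : ℝ) * (2 * ρ)) :=
        mul_le_mul_of_nonneg_left hν2 (by positivity)
      linarith
    have h2 := le_of_mul_le_mul_right h1 hρ0
    have h3 : α * ε ≤ α * ρ := mul_le_mul_of_nonneg_left hfar.le hα0.le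
    rw [div_mul_eq_mul_div, div_le_iff₀ (by positivity)]
    linarith
  · rcases le_or_gt (sigma X r) (2 * α / β * sigma X rs) with hle | hlt
    · exact Or.inl hle
    · exact Or.inr fun Y hY => hc3 hlt _ (hX.norm_sq_sub_le_of_isRankProjection hY)

end LoRA

theorem theorem3 (m n r rs : ℕ) (hr : rs ≤ r) (α β D R : ℝ) (hα : 0 < α) :
    ∃ c : ℝ, 0 < c ∧
      ∀ (ε δ lam : ℝ), 0 < ε → 0 ≤ lam → δ ≤ c * ε ^ 3 →
      ∀ (f : Matrix (Fin m) (Fin n) ℝ → ℝ) (Xs Xδ : Matrix (Fin m) (Fin n) ℝ),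
        LoRA.TwiceDifferentiable f →
        LoRA.IsGlobalMinimizer (LoRA.fullLoss f lam) Xs → ‖Xs‖ ≤ R →
        Xδ.rank = rs → ‖Xδ - Xs‖ ≤ δ →
        LoRA.RestrictedStronglyConvex f Xs α r D →
        LoRA.RestrictedSmooth f Xs β r D →
      ∀ (A : Matrix (Fin m) (Fin r) ℝ) (B : Matrix (Fin n) (Fin r) ℝ)
        (X : Matrix (Fin m) (Fin n) ℝ),
        LoRA.IsSOSP (LoRA.loraLoss r f lam) (A, B) → X = A * Bᵀ → ‖X - Xs‖ ≤ D →
        (β * (1 + ε) ≤ 2 * α →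
          LoRA.IsApproxGlobalMinimizer (LoRA.fullLoss f lam) ε X) ∧
        (2 * α < β * (1 + ε) →
          LoRA.IsApproxGlobalMinimizer (LoRA.fullLoss f lam) ε X ∨
          (¬ LoRA.IsApproxGlobalMinimizer (LoRA.fullLoss f lam) ε X ∧
            1 ≤ rs ∧
            X.rank = r ∧
            max (2 * α / (β * (1 + ε)) * LoRA.sigma X rs) (α / (2 * β * √(r : ℝ)) * ε)
              ≤ LoRA.sigma X r ∧
            (LoRA.sigma X r ≤ 2 * α / β * LoRA.sigma X rs ∨
              ∀ P : Matrix (Fin m) (Fin n) ℝ, LoRA.IsRankProjection rs X P →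
                √((‖X - P‖ ^ 2 - ε ^ 3) /
                    (1 - 2 * α * LoRA.sigma X rs / (β * LoRA.sigma X r))) - ε ^ 2
                  ≤ ‖X - Xs‖))) := by
  -- L bounds ‖X⋆‖, ‖X‖ and D, and hence ε in the far case; the summand 1 makes powers of L
  -- comparable.
  set L : ℝ := |R| + |D| + 1 with hL
  have hR0 := abs_nonneg R
  have hD0 := abs_nonneg D
  have hL1 : 1 ≤ L := by linarith
  have hL0 : 0 < L := by linarith
  set K₁ : ℝ := 20 * L ^ 3 * (n + 1) with hK₁
  set K₂ : ℝ := (|β| + 1) * L ^ 2 * (n + 1) with hK₂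
  have hK₁0 : 0 < K₁ := by positivity
  have hK₂0 : 0 < K₂ := by positivity
  -- The factor 2 makes the second smallness condition strict, as the exclusion of r⋆ = 0 requires.
  refine ⟨min (1 / K₁) (α / (2 * K₂)), by positivity, ?_⟩
  rintro ε δ lam hε hlam hδc f Xs Xδ hf hmin hXsR hXδ hδ hcvx hsmooth A B X hS rfl hXD
  have hε3 : 0 < ε ^ 3 := by positivity
  have hδ₁ : K₁ * δ ≤ ε ^ 3 := by
    have h1 := hδc.trans (mul_le_mul_of_nonneg_right (min_le_left _ _) hε3.le)
    rw [one_div, inv_mul_eq_div, le_div_iff₀ hK₁0] at h1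
    linarith
  have hδ₂ : K₂ * δ < α * ε ^ 3 := by
    have h1 := hδc.trans (mul_le_mul_of_nonneg_right (min_le_right _ _) hε3.le)
    rw [div_mul_eq_mul_div, le_div_iff₀ (by positivity)] at h1
    have : 0 < α * ε ^ 3 := by positivity
    linarith
  have hXsL : ‖Xs‖ ≤ L := by linarith [le_abs_self R]
  have hXL : ‖A * Bᵀ‖ ≤ L := by
    have := norm_add_le (A * Bᵀ - Xs) Xs
    rw [sub_add_cancel] at this
    linarith [le_abs_self R, le_abs_self D]
  have hkey : ¬ LoRA.IsApproxGlobalMinimizer (LoRA.fullLoss f lam) ε (A * Bᵀ) → _ := fun hna =>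
    LoRA.sosp_bounds_of_far hr hf hlam hα hmin hcvx hsmooth hS hXD hε
      (not_le.mp fun hle => hna ⟨Xs, hmin, hle⟩) hL1 (by linarith [le_abs_self D]) hXL hXsL hXδ hδ
      hδ₁ hδ₂
  refine ⟨fun hcase => ?_, fun _ => ?_⟩
  · by_contra hna
    exact absurd (hkey hna).1 (not_lt.mpr hcase)
  · by_cases hna : LoRA.IsApproxGlobalMinimizer (LoRA.fullLoss f lam) ε (A * Bᵀ)
    · exact Or.inl hna
    · exact Or.inr ⟨hna, (hkey hna).2⟩
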